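/- Let $0<k<1$, $k'=\sqrt{1-k^2}$, $K=K(k)=\int_0^{\pi/2}\frac{du}{\sqrt{1-k^2\sin^2u}}$, $K'=K(k')$, $\tau=iK'/K$, and write $\theta_3(v)=\sum_{n\in\mathbb Z}e^{i\pi(n^2\tau+2nv)}$, $\theta_4(v)=\theta_3(v+\tfrac12)$, $\theta_2(v)=\sum_{n\in\mathbb Z}e^{i\pi((n+1/2)^2\tau+(2n+1)v)}$, $\theta_1(v)=\theta_2(v-\tfrac12)$ for the Jacobi theta functions. Let $P_s=(\zeta_s,\eta_s)$, $s=1,\dots,4$, be points of the affine curve $$0=\eta^2+\tfrac{K^2}{4}\left(\zeta^4+2(k^2-k'^2)\zeta^2+1\right),$$ and let $\alpha_s=\frac14\int_{\infty_1}^{P_s}\frac{d\zeta}{\eta}$ be their Abel images, taken along arbitrary paths on the curve, where $\infty_1$ is the point over $\zeta=\infty$ at which $\eta/\zeta^2=-iK/2$. For $z\in\mathbb C$ put $a_s=-\theta_3(\alpha_s)\theta_2(\alpha_s-z/2)$, $b_s=\theta_1(\alpha_s)\theta_4(\alpha_s-z/2)$, and let $\Psi$ be the $4\times4$ matrix whose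 $s$-th column is $$\begin{pmatrix}1\\ i\zeta_s\end{pmatrix}\otimes\begin{pmatrix}a_s\\ b_s\end{pmatrix}=(a_s,\;b_s,\;i\zeta_sa_s,\;i\zeta_sb_s)^T .$$ Then $\theta_1(\alpha_s)\ne0\ne\theta_3(\alpha_s)$ for all $s$, and for every choice of distinct $i,j,k,l\in\{1,2,3,4\}$ the $i$-th column of $\operatorname{Adj}(\Psi)^T$ (the transpose of the classical adjoint) is $$\begin{pmatrix} i\zeta_j\,\frac{\theta_2(z/2)\,\theta_2(\sum_{s\ne i}\alpha_s-z/2)}{\prod_{s\ne i}\theta_3(\alpha_s)}-\frac{\theta_2(0)\theta_4(0)\theta_3(\alpha_j+\alpha_k)\theta_3(\alpha_j+\alpha_l)\theta_4(\alpha_j-z/2)\theta_4(\alpha_k+\alpha_l-z/2)}{\theta_3(\alpha_j)\prod_{s\ne i}\theta_1(\alpha_s)\theta_3(\alpha_s)}\\[2ex] i\zeta_j\,\frac{\theta_2(z/2)\,\theta_4(\sum_{s\ne i}\alpha_s-z/2)}{\prod_{s\ne i}\theta_1(\alpha_s)}-\frac{\theta_2(0)\theta_4(0)\theta_3(\alpha_j+\alpha_k)\theta_3(\alpha_j+\alpha_l)\theta_2(\alpha_j-z/2)\theta_4(\alpha_k+\alpha_l-z/2)}{\theta_1(\alpha_j)\prod_{s\ne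 i}\theta_1(\alpha_s)\theta_3(\alpha_s)}\\[2ex] -\frac{\theta_2(z/2)\,\theta_2(\sum_{s\ne i}\alpha_s-z/2)}{\prod_{s\ne i}\theta_3(\alpha_s)}\\[2ex] -\frac{\theta_2(z/2)\,\theta_4(\sum_{s\ne i}\alpha_s-z/2)}{\prod_{s\ne i}\theta_1(\alpha_s)} \end{pmatrix}d_i,$$ where, with the totally antisymmetric symbol normalized by $\epsilon_{1234}=1$, $$d_i=-\epsilon_{ijkl}\,\theta_2(0)\theta_3(0)\theta_4(0)\,\theta_1(\alpha_j-\alpha_k)\theta_1(\alpha_j-\alpha_l)\theta_1(\alpha_k-\alpha_l)\,\theta_2(z/2).$$ Here $i$ in front of $\zeta$ and in exponents is the imaginary unit, and an index elsewhere; $k$ as an index is unrelated to the modulus $k$. -/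

import Mathlib

namespace MonopoleCurve

open Filter Topology

noncomputable section

/-- Jacobi's `θ₃(v|τ) = ∑ₙ exp (iπ (n² τ + 2 n v))`. -/
def theta3 (τ v : ℂ) : ℂ := jacobiTheta₂ v τ

/-- Jacobi's `θ₄(v|τ) = ∑ₙ (-1)ⁿ exp (iπ (n² τ + 2 n v)) = θ₃(v + 1/2)`. -/
def theta4 (τ v : ℂ) : ℂ := jacobiTheta₂ (v + 1 / 2) τ

/-- Jacobi's `θ₂(v|τ) = ∑ₙ exp (iπ ((n + 1/2)² τ + (2 n + 1) v))`. -/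
def theta2 (τ v : ℂ) : ℂ :=
  Complex.exp (Real.pi * Complex.I * (τ / 4 + v)) * jacobiTheta₂ (v + τ / 2) τ

/-- Jacobi's `θ₁(v|τ) = θ₂(v - 1/2|τ) = 2 ∑_{n ≥ 0} (-1)ⁿ q^{(n+1/2)²} sin ((2n+1) π v)`,
where `q = exp (iπτ)`. -/
def theta1 (τ v : ℂ) : ℂ := theta2 τ (v - 1 / 2)

/-- The complete elliptic integral of the first kind with modulus `k`. -/
def ellipticK (k : ℝ) : ℝ :=
  ∫ u in (0 : ℝ)..(Real.pi / 2), 1 / √(1 - k ^ 2 * Real.sin u ^ 2)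

/-- The complementary modulus `k'`. -/
def coModulus (k : ℝ) : ℝ := √(1 - k ^ 2)

/-- The period `τ = i K' / K`, with `K' = K(k')`. -/
def period (k : ℝ) : ℂ :=
  Complex.I * (ellipticK (coModulus k) : ℂ) / (ellipticK k : ℂ)

/-- The affine spectral curve `0 = η² + (K²/4) (ζ⁴ + 2 (k² - k'²) ζ² + 1)`. -/
def OnCurve (k : ℝ) (ζ η : ℂ) : Prop :=
  0 = η ^ 2 + (ellipticK k : ℂ) ^ 2 / 4 *
    (ζ ^ 4 + 2 * ((k : ℂ) ^ 2 - (coModulus k : ℂ) ^ 2) * ζ ^ 2 + 1)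

/-- `t ↦ (ζ t, η t)`, `0 < t ≤ 1`, is a continuously differentiable path on the curve that starts
(as `t → 0`) at the point `∞₁`, the point over `ζ = ∞` at which `η / ζ² = - i K / 2`, ends at
`(ζ₀, η₀)`, and meets no branch point `η = 0` before its end. -/
structure IsPathFromInfinity (k : ℝ) (ζ η : ℝ → ℂ) (ζ₀ η₀ : ℂ) : Prop where
  contDiffOn_zeta : ContDiffOn ℝ 1 ζ (Set.Ioc 0 1)
  contDiffOn_eta : ContDiffOn ℝ 1 η (Set.Ioc 0 1)
  onCurve : ∀ t ∈ Set.Ioc (0 : ℝ) 1, OnCurve k (ζ t) (η t)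
  eta_ne_zero : ∀ t ∈ Set.Ioo (0 : ℝ) 1, η t ≠ 0
  tendsto_zeta : Tendsto (fun t => ‖ζ t‖) (𝓝[>] 0) atTop
  tendsto_sheet :
    Tendsto (fun t => η t / ζ t ^ 2) (𝓝[>] 0) (𝓝 (-(Complex.I * (ellipticK k : ℂ) / 2)))
  zeta_one : ζ 1 = ζ₀
  eta_one : η 1 = η₀

/-- `α` is a value of the Abel map `∫_{∞₁}^{P} dζ / (4 η)` at `P = (ζ₀, η₀)`, along some path. -/
def IsAbelImage (k : ℝ) (ζ₀ η₀ α : ℂ) : Prop :=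
  ∃ ζ η : ℝ → ℂ, IsPathFromInfinity k ζ η ζ₀ η₀ ∧
    Tendsto (fun ε : ℝ => ∫ t in ε..1, deriv ζ t / (4 * η t)) (𝓝[>] 0) (𝓝 α)

/-- `a = - θ₃(α) θ₂(α - z/2)`. -/
def aEntry (τ z α : ℂ) : ℂ := -(theta3 τ α * theta2 τ (α - z / 2))

/-- `b = θ₁(α) θ₄(α - z/2)`. -/
def bEntry (τ z α : ℂ) : ℂ := theta1 τ α * theta4 τ (α - z / 2)

/-- The matrix `Ψ` with columns `(1, i ζ_c) ⊗ (a_c, b_c)`. -/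
def Psi (τ z : ℂ) (ζ α : Fin 4 → ℂ) : Matrix (Fin 4) (Fin 4) ℂ :=
  Matrix.of ![
    fun c => aEntry τ z (α c),
    fun c => bEntry τ z (α c),
    fun c => Complex.I * ζ c * aEntry τ z (α c),
    fun c => Complex.I * ζ c * bEntry τ z (α c)]

/-- The totally antisymmetric symbol `ε_{ijkl}` on four indices, as the product of the signs of the
differences `y - x` over all pairs with `x` standing before `y`. -/
def leviCivita (i j k l : Fin 4) : ℤ :=
  Int.sign ((j.val : ℤ) - i.val) * Int.sign ((k.val : ℤ) - i.val) *
    Int.sign ((l.val : ℤ) - i.val) * Int.sign ((k.val : ℤ) - j.val) *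
    Int.sign ((l.val : ℤ) - j.val) * Int.sign ((l.val : ℤ) - k.val)

/-- The scalar factor `d_i` (with the choice of the remaining indices `j, k, l`). -/
def dFactor (τ z : ℂ) (α : Fin 4 → ℂ) (i j k l : Fin 4) : ℂ :=
  -(leviCivita i j k l : ℂ) * (theta2 τ 0 * theta3 τ 0 * theta4 τ 0) *
    (theta1 τ (α j - α k) * theta1 τ (α j - α l) * theta1 τ (α k - α l)) * theta2 τ (z / 2)

/-- The column vector that multiplies `d_i`. -/
def adjVector (τ z : ℂ) (ζ α : Fin 4 → ℂ) (i j k l : Fin 4) : Fin 4 → ℂ :=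
  ![Complex.I * ζ j *
        (theta2 τ (z / 2) * theta2 τ ((∑ s ∈ Finset.univ.erase i, α s) - z / 2) /
          ∏ s ∈ Finset.univ.erase i, theta3 τ (α s)) -
      theta2 τ 0 * theta4 τ 0 * theta3 τ (α j + α k) * theta3 τ (α j + α l) *
          theta4 τ (α j - z / 2) * theta4 τ (α k + α l - z / 2) /
        (theta3 τ (α j) * ∏ s ∈ Finset.univ.erase i, theta1 τ (α s) * theta3 τ (α s)),
    Complex.I * ζ j *
        (theta2 τ (z / 2) * theta4 τ ((∑ s ∈ Finset.univ.erase i, α s) - z / 2) /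
          ∏ s ∈ Finset.univ.erase i, theta1 τ (α s)) -
      theta2 τ 0 * theta4 τ 0 * theta3 τ (α j + α k) * theta3 τ (α j + α l) *
          theta2 τ (α j - z / 2) * theta4 τ (α k + α l - z / 2) /
        (theta1 τ (α j) * ∏ s ∈ Finset.univ.erase i, theta1 τ (α s) * theta3 τ (α s)),
    -(theta2 τ (z / 2) * theta2 τ ((∑ s ∈ Finset.univ.erase i, α s) - z / 2) /
        ∏ s ∈ Finset.univ.erase i, theta3 τ (α s)),
    -(theta2 τ (z / 2) * theta4 τ ((∑ s ∈ Finset.univ.erase i, α s) - z / 2) /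
        ∏ s ∈ Finset.univ.erase i, theta1 τ (α s))]

end

end MonopoleCurve

/-!
Write `κ = θ₂(0)² / θ₃(0)²` with theta constants at `τ = i t`. Then `K(κ)` and `K(κ')` are theta
constants and `τ` is the period of `κ`, so `v ↦ (ζ, η)` with `i ζ = θ₂ θ₄ / (θ₁ θ₃)`,
`4 i η = d (i ζ) / dv` parametrises the curve. Both the parametrised point and the given path solve
`dζ = 4 η dv`, so along every path from `∞₁` the Abel integral `v` inverts the parametrisation.
Substituting it into `Ψ`, the three-term theta identities collapse the `3 × 3` minors into products.
-/

namespace MonopoleCurve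

open Complex Filter Topology

/-! ### Product formulas and three-term relations -/

/-- Parametrisation of the pairs of integers with even sum, by `(p + q, p - q)`, and of those with
odd sum, by `(p + q + 1, p - q)`. -/
def parityPairs : (ℤ × ℤ) ⊕ (ℤ × ℤ) → ℤ × ℤ :=
  Sum.elim (fun p => (p.1 + p.2, p.1 - p.2)) (fun p => (p.1 + p.2 + 1, p.1 - p.2))

lemma parityPairs_bijective : Function.Bijective parityPairs := by
  constructor
  · rintro (⟨a, b⟩ | ⟨a, b⟩) (⟨c, d⟩ | ⟨c, d⟩) h <;>
      simp only [parityPairs, Sum.elim_inl, Sum.elim_inr, Prod.mk.injEq, Sum.inl.injEq,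
        Sum.inr.injEq, reduceCtorEq] at h ⊢ <;> omega
  · rintro ⟨m, n⟩
    rcases Int.even_or_odd' (m + n) with ⟨p, hp | hp⟩
    · exact ⟨Sum.inl (p, m - p), by simp only [parityPairs, Sum.elim_inl, Prod.mk.injEq]; omega⟩
    · exact ⟨Sum.inr (p, m - 1 - p), by
        simp only [parityPairs, Sum.elim_inr, Prod.mk.injEq]; omega⟩

lemma hasSum_prod_mul {ι κ : Type*} {f : ι → ℂ} {g : κ → ℂ} {a b : ℂ} (hf : HasSum f a)
    (hg : HasSum g b) : HasSum (fun p : ι × κ => f p.1 * g p.2) (a * b) :=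
  hf.mul hg (summable_mul_of_summable_norm hf.summable.norm hg.summable.norm)

lemma hasSum_jacobiTheta₂_mul (u v : ℂ) {τ : ℂ} (hτ : 0 < τ.im) :
    HasSum (fun p : ℤ × ℤ => jacobiTheta₂_term p.1 u τ * jacobiTheta₂_term p.2 v τ)
      (jacobiTheta₂ u τ * jacobiTheta₂ v τ) := by
  have h := hasSum_prod_mul (f := (jacobiTheta₂_term · u τ)) (g := (jacobiTheta₂_term · v τ))
    (hasSum_jacobiTheta₂_term u hτ) (hasSum_jacobiTheta₂_term v hτ)
  simpa only using h

lemma theta3_mul_theta3 (x y : ℂ) {τ : ℂ} (hτ : 0 < τ.im) :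
    theta3 τ x * theta3 τ y =
      theta3 (2 * τ) (x + y) * theta3 (2 * τ) (x - y) +
        theta2 (2 * τ) (x + y) * theta2 (2 * τ) (x - y) := by
  have h2τ : 0 < (2 * τ).im := by simpa using hτ
  have hEven := hasSum_jacobiTheta₂_mul (x + y) (x - y) h2τ
  have hOdd := (hasSum_jacobiTheta₂_mul (x + y + 2 * τ / 2) (x - y + 2 * τ / 2) h2τ).mul_left
    (cexp (Real.pi * I * (2 * τ / 4 + (x + y))) * cexp (Real.pi * I * (2 * τ / 4 + (x - y))))
  have hAll := ((Equiv.ofBijective _ parityPairs_bijective).hasSum_iff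
    (f := fun p : ℤ × ℤ => jacobiTheta₂_term p.1 x τ * jacobiTheta₂_term p.2 y τ)).2
    (hasSum_jacobiTheta₂_mul x y hτ)
  have h := hAll.unique <| HasSum.sum (hEven.congr_fun fun p => ?_) (hOdd.congr_fun fun p => ?_)
  · simp only [theta3, theta2]
    rw [h]
    ring
  all_goals
    simp only [parityPairs, Function.comp_apply, Equiv.ofBijective_apply, Sum.elim_inl,
      Sum.elim_inr, jacobiTheta₂_term, ← Complex.exp_add]
    congr 1
    push_cast
    ring

lemma theta3_neg (τ v : ℂ) : theta3 τ (-v) = theta3 τ v := jacobiTheta₂_neg_left v τ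

lemma theta3_add_one (τ v : ℂ) : theta3 τ (v + 1) = theta3 τ v := jacobiTheta₂_add_left v τ

lemma theta3_add_half (τ v : ℂ) : theta3 τ (v + 1 / 2) = theta4 τ v := rfl

lemma theta4_add_half (τ v : ℂ) : theta4 τ (v + 1 / 2) = theta3 τ v := by
  rw [← theta3_add_half, add_assoc, add_halves, theta3_add_one]

lemma theta4_neg (τ v : ℂ) : theta4 τ (-v) = theta4 τ v := by
  rw [← theta3_add_half, ← theta3_neg, ← theta3_add_one, ← theta3_add_half]
  congr 1
  ring

lemma theta2_add_one (τ v : ℂ) : theta2 τ (v + 1) = -theta2 τ v := by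
  rw [theta2, theta2, show v + 1 + τ / 2 = v + τ / 2 + 1 by ring, jacobiTheta₂_add_left,
    show (Real.pi : ℂ) * I * (τ / 4 + (v + 1)) = Real.pi * I * (τ / 4 + v) + Real.pi * I by ring,
    Complex.exp_add, exp_pi_mul_I]
  ring

lemma theta2_neg (τ v : ℂ) : theta2 τ (-v) = theta2 τ v := by
  rw [theta2, theta2, ← jacobiTheta₂_neg_left (v + τ / 2),
    show -v + τ / 2 = -(v + τ / 2) + τ by ring, jacobiTheta₂_add_left', ← mul_assoc,
    ← Complex.exp_add]
  congr 2
  ring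

lemma theta1_add_half (τ v : ℂ) : theta1 τ (v + 1 / 2) = theta2 τ v := by
  rw [theta1, add_sub_cancel_right]

lemma theta2_add_half (τ v : ℂ) : theta2 τ (v + 1 / 2) = -theta1 τ v := by
  rw [theta1, ← theta2_add_one]
  congr 1
  ring

lemma theta1_neg (τ v : ℂ) : theta1 τ (-v) = -theta1 τ v := by
  rw [theta1, ← theta2_neg, ← theta2_add_half]
  congr 1
  ring

lemma theta1_zero (τ : ℂ) : theta1 τ 0 = 0 := by
  have h := theta1_neg τ 0
  rw [neg_zero] at h
  linear_combination h / 2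

/-- The exponential factor picked up by the theta functions under translation by `τ / 2`. -/
noncomputable def halfShift (τ v : ℂ) : ℂ := cexp (-(Real.pi * I * (τ / 4 + v)))

lemma halfShift_ne_zero (τ v : ℂ) : halfShift τ v ≠ 0 := Complex.exp_ne_zero _

lemma halfShift_mul_halfShift (τ : ℂ) {u v u' v' : ℂ} (h : u + v = u' + v') :
    halfShift τ u * halfShift τ v = halfShift τ u' * halfShift τ v' := by
  rw [halfShift, halfShift, halfShift, halfShift, ← Complex.exp_add, ← Complex.exp_add]
  congr 1
  linear_combination -(Real.pi * I) * h

lemma halfShift_add_half (τ v : ℂ) : halfShift τ (v + 1 / 2) = -I * halfShift τ v := by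
  have h : cexp (-(Real.pi / 2 * I)) = -I := by
    rw [Complex.exp_neg, exp_pi_div_two_mul_I, inv_I]
  rw [halfShift, halfShift, ← h, ← Complex.exp_add]
  congr 1
  ring

lemma theta3_add_half_period (τ v : ℂ) : theta3 τ (v + τ / 2) = halfShift τ v * theta2 τ v := by
  rw [theta3, theta2, halfShift, ← mul_assoc, ← Complex.exp_add, neg_add_cancel, Complex.exp_zero,
    one_mul]

lemma theta2_add_half_period (τ v : ℂ) : theta2 τ (v + τ / 2) = halfShift τ v * theta3 τ v := by
  rw [theta3, theta2, halfShift, show v + τ / 2 + τ / 2 = v + τ by ring, jacobiTheta₂_add_left',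
    ← mul_assoc, ← Complex.exp_add]
  congr 2
  ring

lemma theta3_add_half_add_half_period (τ v : ℂ) :
    theta3 τ (v + 1 / 2 + τ / 2) = I * halfShift τ v * theta1 τ v := by
  rw [theta3_add_half_period, theta2_add_half, halfShift_add_half]
  ring

lemma theta2_add_half_add_half_period (τ v : ℂ) :
    theta2 τ (v + 1 / 2 + τ / 2) = -I * halfShift τ v * theta4 τ v := by
  rw [theta2_add_half_period, theta3_add_half, halfShift_add_half]

lemma theta4_add_half_add_half_period (τ v : ℂ) :
    theta4 τ (v + 1 / 2 + τ / 2) = halfShift τ v * theta2 τ v := by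
  rw [add_right_comm, theta4_add_half, theta3_add_half_period]

lemma theta1_add_half_add_half_period (τ v : ℂ) :
    theta1 τ (v + 1 / 2 + τ / 2) = halfShift τ v * theta3 τ v := by
  rw [add_right_comm, theta1_add_half, theta2_add_half_period]

section ProductFormulas

variable (x y : ℂ) {τ : ℂ} (hτ : 0 < τ.im)
include hτ

lemma theta4_mul_theta4 :
    theta4 τ x * theta4 τ y =
      theta3 (2 * τ) (x + y) * theta3 (2 * τ) (x - y) -
        theta2 (2 * τ) (x + y) * theta2 (2 * τ) (x - y) := by
  rw [← theta3_add_half, ← theta3_add_half, theta3_mul_theta3 _ _ hτ,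
    show x + 1 / 2 + (y + 1 / 2) = x + y + 1 by ring,
    show x + 1 / 2 - (y + 1 / 2) = x - y by ring, theta3_add_one, theta2_add_one]
  ring

lemma theta2_mul_theta2 :
    theta2 τ x * theta2 τ y =
      theta2 (2 * τ) (x + y) * theta3 (2 * τ) (x - y) +
        theta3 (2 * τ) (x + y) * theta2 (2 * τ) (x - y) := by
  have h := theta3_mul_theta3 (x + τ / 2) (y + τ / 2) hτ
  rw [show x + τ / 2 + (y + τ / 2) = x + y + 2 * τ / 2 by ring,
    show x + τ / 2 - (y + τ / 2) = x - y by ring, theta3_add_half_period, theta3_add_half_period,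
    theta3_add_half_period, theta2_add_half_period] at h
  have hShift : halfShift (2 * τ) (x + y) = halfShift τ x * halfShift τ y := by
    rw [halfShift, halfShift, halfShift, ← Complex.exp_add]
    congr 1
    ring
  apply mul_left_cancel₀ (mul_ne_zero (halfShift_ne_zero τ x) (halfShift_ne_zero τ y))
  rw [hShift] at h
  linear_combination h

lemma theta1_mul_theta1 :
    theta1 τ x * theta1 τ y =
      theta3 (2 * τ) (x + y) * theta2 (2 * τ) (x - y) -
        theta2 (2 * τ) (x + y) * theta3 (2 * τ) (x - y) := by
  have h := theta2_mul_theta2 (x + 1 / 2) (y + 1 / 2) hτ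
  rw [show x + 1 / 2 + (y + 1 / 2) = x + y + 1 by ring,
    show x + 1 / 2 - (y + 1 / 2) = x - y by ring, theta3_add_one, theta2_add_one,
    theta2_add_half, theta2_add_half] at h
  linear_combination h

end ProductFormulas

section ThreeTermRelations

variable {τ : ℂ} (hτ : 0 < τ.im) (j k l y : ℂ)
include hτ

lemma theta_three_term :
    theta3 τ k * theta3 τ (j + l) * (theta4 τ (l - y) * theta4 τ (j + k - y)) -
      theta3 τ l * theta3 τ (j + k) * (theta4 τ (k - y) * theta4 τ (j + l - y)) =
    theta1 τ j * theta1 τ (k - l) * (theta2 τ y * theta2 τ (j + k + l - y)) := by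
  rw [theta3_mul_theta3 _ _ hτ, theta3_mul_theta3 _ _ hτ, theta4_mul_theta4 _ _ hτ,
    theta4_mul_theta4 _ _ hτ, theta1_mul_theta1 _ _ hτ, theta2_mul_theta2 _ _ hτ,
    show k + (j + l) = j + k + l by ring, show l + (j + k) = j + k + l by ring,
    show l - y + (j + k - y) = j + k + l - 2 * y by ring,
    show k - y + (j + l - y) = j + k + l - 2 * y by ring,
    show l - y - (j + k - y) = l - j - k by ring,
    show k - y - (j + l - y) = k - j - l by ring,
    show k - (j + l) = k - j - l by ring, show l - (j + k) = l - j - k by ring,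
    show j + (k - l) = -(l - j - k) by ring, show j - (k - l) = -(k - j - l) by ring,
    show y + (j + k + l - y) = j + k + l by ring,
    show y - (j + k + l - y) = -(j + k + l - 2 * y) by ring]
  simp only [theta3_neg, theta2_neg]
  ring

lemma theta_three_term_shifted :
    theta3 τ k * theta1 τ (j + l) * (theta4 τ (l - y) * theta2 τ (j + k - y)) -
      theta3 τ l * theta1 τ (j + k) * (theta4 τ (k - y) * theta2 τ (j + l - y)) =
    -(theta3 τ j * theta1 τ (k - l) * (theta2 τ y * theta4 τ (j + k + l - y))) := by
  have h := theta_three_term hτ (j + 1 / 2 + τ / 2) k l y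
  rw [show j + 1 / 2 + τ / 2 + l = j + l + 1 / 2 + τ / 2 by ring,
    show j + 1 / 2 + τ / 2 + k - y = j + k - y + 1 / 2 + τ / 2 by ring,
    show j + 1 / 2 + τ / 2 + k = j + k + 1 / 2 + τ / 2 by ring,
    show j + l + 1 / 2 + τ / 2 - y = j + l - y + 1 / 2 + τ / 2 by ring,
    show j + k + 1 / 2 + τ / 2 + l - y = j + k + l - y + 1 / 2 + τ / 2 by ring,
    theta3_add_half_add_half_period, theta3_add_half_add_half_period,
    theta4_add_half_add_half_period, theta4_add_half_add_half_period,
    theta1_add_half_add_half_period, theta2_add_half_add_half_period] at h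
  have hjl : halfShift τ (j + l) * halfShift τ (j + k - y) =
      halfShift τ j * halfShift τ (j + k + l - y) := halfShift_mul_halfShift τ (by ring)
  have hjk : halfShift τ (j + k) * halfShift τ (j + l - y) =
      halfShift τ j * halfShift τ (j + k + l - y) := halfShift_mul_halfShift τ (by ring)
  apply mul_left_cancel₀ (mul_ne_zero I_ne_zero
    (mul_ne_zero (halfShift_ne_zero τ j) (halfShift_ne_zero τ (j + k + l - y))))
  linear_combination h - I * theta3 τ k * theta1 τ (j + l) * (theta4 τ (l - y) *
    theta2 τ (j + k - y)) * hjl + I * theta3 τ l * theta1 τ (j + k) * (theta4 τ (k - y) *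
    theta2 τ (j + l - y)) * hjk

lemma theta_three_term_mixed :
    theta1 τ k * theta3 τ (j + l) * (theta2 τ (l - y) * theta4 τ (j + k - y)) -
      theta1 τ l * theta3 τ (j + k) * (theta2 τ (k - y) * theta4 τ (j + l - y)) =
    theta3 τ j * theta1 τ (k - l) * (theta2 τ y * theta4 τ (j + k + l - y)) := by
  have h := theta_three_term_shifted hτ (-j) (j + l) (j + k) y
  rw [show -j + (j + k) = k by ring, show -j + (j + l) = l by ring, theta3_neg,
    show j + l - (j + k) = -(k - l) by ring, theta1_neg,
    show l + (j + k) = j + k + l by ring] at h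
  linear_combination h

end ThreeTermRelations

/-- The numerator `θ₂ θ₄` of the meromorphic function `i ζ` of the Abel image. -/
noncomputable def thetaNum (τ v : ℂ) : ℂ := theta2 τ v * theta4 τ v

/-- The denominator `θ₁ θ₃` of the meromorphic function `i ζ` of the Abel image. -/
noncomputable def thetaDen (τ v : ℂ) : ℂ := theta1 τ v * theta3 τ v

lemma thetaDen_mul_thetaNum_sub {τ : ℂ} (hτ : 0 < τ.im) (u v : ℂ) :
    thetaDen τ u * thetaNum τ v - thetaNum τ u * thetaDen τ v =
      theta2 τ 0 * theta4 τ 0 * (theta1 τ (u - v) * theta3 τ (u + v)) := by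
  have h := theta_three_term_shifted hτ (-(u + v)) u v 0
  rw [show -(u + v) + u + v = 0 by ring, show -(u + v) + v = -u by ring,
    show -(u + v) + u = -v by ring, sub_zero, sub_zero, sub_zero, sub_zero, sub_zero, theta3_neg,
    theta1_neg, theta1_neg, theta2_neg, theta2_neg] at h
  simp only [thetaDen, thetaNum]
  linear_combination -h

/-! ### The adjugate of `Ψ` -/

section Adjugate

lemma adjugate_apply_perm {n R : Type*} [Fintype n] [DecidableEq n] [CommRing R]
    (A : Matrix n n R) (σ : Equiv.Perm n) (i r : n) :
    A.adjugate (σ i) r = (Equiv.Perm.sign σ : ℤ) * (A.submatrix id σ).adjugate i r := by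
  have hrow : (A.submatrix id σ).updateRow r (Pi.single i 1) =
      (A.updateRow r (Pi.single (σ i) 1)).submatrix id σ := by
    rw [show Pi.single (σ i) (1 : R) = Pi.single i 1 ∘ σ.symm from
      (Pi.single_comp_equiv σ.symm i 1).symm]
    exact A.updateRow_submatrix_equiv r _ (Equiv.refl n) σ
  rw [Matrix.adjugate_apply, Matrix.adjugate_apply, hrow, Matrix.det_permute', ← mul_assoc,
    ← Int.cast_mul, ← Units.val_mul, Int.units_mul_self, Units.val_one, Int.cast_one, one_mul]

/-- Subtracting `w 1` times the first two rows from the last two reduces every cofactor to a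
`2 × 2` minor of the rows `a`, `b` and differences of the entries of `w`. -/
lemma adjugate_zero_of_proportional_rows {R : Type*} [CommRing R] (a b w : Fin 4 → R) :
    (Matrix.of ![a, b, w * a, w * b]).adjugate 0 =
      ![b 1 * ((w 2 - w 1) * (w 3 - w 1) * (a 2 * b 3 - a 3 * b 2)) -
          w 1 * ((w 3 - w 1) * b 3 * (a 1 * b 2 - a 2 * b 1) -
            (w 2 - w 1) * b 2 * (a 1 * b 3 - a 3 * b 1)),
        -(a 1 * ((w 2 - w 1) * (w 3 - w 1) * (a 2 * b 3 - a 3 * b 2))) +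
          w 1 * ((w 3 - w 1) * a 3 * (a 1 * b 2 - a 2 * b 1) -
            (w 2 - w 1) * a 2 * (a 1 * b 3 - a 3 * b 1)),
        (w 3 - w 1) * b 3 * (a 1 * b 2 - a 2 * b 1) - (w 2 - w 1) * b 2 * (a 1 * b 3 - a 3 * b 1),
        -((w 3 - w 1) * a 3 * (a 1 * b 2 - a 2 * b 1) -
          (w 2 - w 1) * a 2 * (a 1 * b 3 - a 3 * b 1))] := by
  ext r
  rw [Matrix.adjugate_fin_succ_eq_det_submatrix, Matrix.det_fin_three]
  fin_cases r <;> simp [Fin.succAbove] <;> ring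

end Adjugate

section ThetaMinors

variable {τ : ℂ} (hτ : 0 < τ.im) (z : ℂ) {p q r : ℂ}
include hτ

lemma aEntry_mul_bEntry_sub (p q : ℂ) :
    aEntry τ z p * bEntry τ z q - aEntry τ z q * bEntry τ z p =
      theta3 τ 0 * theta1 τ (p - q) * (theta2 τ (z / 2) * theta4 τ (p + q - z / 2)) := by
  have h := theta_three_term_mixed hτ 0 p q (z / 2)
  simp only [zero_add] at h
  rw [← h, aEntry, aEntry, bEntry, bEntry]
  ring

lemma thetaNum_div_thetaDen_sub (hp : thetaDen τ p ≠ 0) (hq : thetaDen τ q ≠ 0) :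
    thetaNum τ q / thetaDen τ q - thetaNum τ p / thetaDen τ p =
      theta2 τ 0 * theta4 τ 0 * (theta1 τ (p - q) * theta3 τ (p + q)) /
        (thetaDen τ p * thetaDen τ q) := by
  rw [← thetaDen_mul_thetaNum_sub hτ]
  field_simp

variable (hp : thetaDen τ p ≠ 0) (hq : thetaDen τ q ≠ 0) (hr : thetaDen τ r ≠ 0)
include hp hq hr

lemma minor_bEntry :
    (thetaNum τ r / thetaDen τ r - thetaNum τ p / thetaDen τ p) * bEntry τ z r *
        (aEntry τ z p * bEntry τ z q - aEntry τ z q * bEntry τ z p) -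
      (thetaNum τ q / thetaDen τ q - thetaNum τ p / thetaDen τ p) * bEntry τ z q *
        (aEntry τ z p * bEntry τ z r - aEntry τ z r * bEntry τ z p) =
    theta2 τ 0 * theta3 τ 0 * theta4 τ 0 *
        (theta1 τ (p - q) * theta1 τ (p - r) * theta1 τ (q - r)) * theta2 τ (z / 2) *
      (theta2 τ (z / 2) * theta2 τ (p + q + r - z / 2) /
        (theta3 τ p * (theta3 τ q * theta3 τ r))) := by
  rw [thetaNum_div_thetaDen_sub hτ hp hr, thetaNum_div_thetaDen_sub hτ hp hq,
    aEntry_mul_bEntry_sub hτ, aEntry_mul_bEntry_sub hτ]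
  obtain ⟨hp1, hp3⟩ := mul_ne_zero_iff.1 hp
  obtain ⟨hq1, hq3⟩ := mul_ne_zero_iff.1 hq
  obtain ⟨hr1, hr3⟩ := mul_ne_zero_iff.1 hr
  simp only [bEntry, thetaDen]
  generalize z / 2 = y
  field_simp
  linear_combination theta2 τ 0 * theta3 τ 0 * theta4 τ 0 * theta1 τ (p - q) *
    theta1 τ (p - r) * theta2 τ y * theta_three_term hτ p q r y

lemma minor_aEntry :
    (thetaNum τ r / thetaDen τ r - thetaNum τ p / thetaDen τ p) * aEntry τ z r *
        (aEntry τ z p * bEntry τ z q - aEntry τ z q * bEntry τ z p) -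
      (thetaNum τ q / thetaDen τ q - thetaNum τ p / thetaDen τ p) * aEntry τ z q *
        (aEntry τ z p * bEntry τ z r - aEntry τ z r * bEntry τ z p) =
    -(theta2 τ 0 * theta3 τ 0 * theta4 τ 0 *
        (theta1 τ (p - q) * theta1 τ (p - r) * theta1 τ (q - r)) * theta2 τ (z / 2) *
      (theta2 τ (z / 2) * theta4 τ (p + q + r - z / 2) /
        (theta1 τ p * (theta1 τ q * theta1 τ r)))) := by
  rw [thetaNum_div_thetaDen_sub hτ hp hr, thetaNum_div_thetaDen_sub hτ hp hq,
    aEntry_mul_bEntry_sub hτ, aEntry_mul_bEntry_sub hτ]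
  obtain ⟨hp1, hp3⟩ := mul_ne_zero_iff.1 hp
  obtain ⟨hq1, hq3⟩ := mul_ne_zero_iff.1 hq
  obtain ⟨hr1, hr3⟩ := mul_ne_zero_iff.1 hr
  simp only [aEntry, thetaDen]
  generalize z / 2 = y
  field_simp
  linear_combination -theta2 τ 0 * theta3 τ 0 * theta4 τ 0 * theta1 τ (p - q) *
    theta1 τ (p - r) * theta2 τ y * theta_three_term_mixed hτ p q r y

lemma quotient_sub_mul_minor :
    (thetaNum τ q / thetaDen τ q - thetaNum τ p / thetaDen τ p) *
        (thetaNum τ r / thetaDen τ r - thetaNum τ p / thetaDen τ p) *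
        (aEntry τ z q * bEntry τ z r - aEntry τ z r * bEntry τ z q) =
    theta2 τ 0 * theta3 τ 0 * theta4 τ 0 *
        (theta1 τ (p - q) * theta1 τ (p - r) * theta1 τ (q - r)) * theta2 τ (z / 2) *
      (theta2 τ 0 * theta4 τ 0 * theta3 τ (p + q) * theta3 τ (p + r) *
        theta4 τ (q + r - z / 2) /
        (thetaDen τ p * (thetaDen τ p * (thetaDen τ q * thetaDen τ r)))) := by
  rw [thetaNum_div_thetaDen_sub hτ hp hr, thetaNum_div_thetaDen_sub hτ hp hq,
    aEntry_mul_bEntry_sub hτ]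
  generalize z / 2 = y
  field_simp

end ThetaMinors

section AdjugatePsi

lemma sign_eq_leviCivita (σ : Equiv.Perm (Fin 4)) :
    (Equiv.Perm.sign σ : ℤ) = leviCivita (σ 0) (σ 1) (σ 2) (σ 3) := by
  revert σ
  decide

lemma sum_univ_erase_zero {M : Type*} [AddCommMonoid M] (f : Fin 4 → M) :
    ∑ s ∈ Finset.univ.erase 0, f s = f 1 + f 2 + f 3 := by
  rw [show (Finset.univ.erase 0 : Finset (Fin 4)) = {1, 2, 3} by decide]
  simp [add_assoc]

lemma prod_univ_erase_zero {M : Type*} [CommMonoid M] (f : Fin 4 → M) :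
    ∏ s ∈ Finset.univ.erase 0, f s = f 1 * (f 2 * f 3) := by
  rw [show (Finset.univ.erase 0 : Finset (Fin 4)) = {1, 2, 3} by decide]
  simp

lemma adjVector_perm (τ z : ℂ) (ζ α : Fin 4 → ℂ) (σ : Equiv.Perm (Fin 4)) :
    adjVector τ z ζ α (σ 0) (σ 1) (σ 2) (σ 3) = adjVector τ z (ζ ∘ σ) (α ∘ σ) 0 1 2 3 := by
  have herase : (Finset.univ.erase (σ 0) : Finset (Fin 4)) =
      (Finset.univ.erase 0).map σ.toEmbedding := by
    rw [Finset.map_erase, Finset.map_univ_equiv, Equiv.coe_toEmbedding]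
  simp only [adjVector, herase, Finset.sum_map, Finset.prod_map, Equiv.coe_toEmbedding,
    Function.comp_apply]

lemma Psi_submatrix_perm (τ z : ℂ) (ζ α : Fin 4 → ℂ) (σ : Equiv.Perm (Fin 4)) :
    (Psi τ z ζ α).submatrix id σ = Psi τ z (ζ ∘ σ) (α ∘ σ) := by
  ext r c
  fin_cases r <;> rfl

variable {τ : ℂ} (hτ : 0 < τ.im) (z : ℂ) {ζ α : Fin 4 → ℂ} (hα : ∀ s, thetaDen τ (α s) ≠ 0)
  (hζ : ∀ s, I * ζ s = thetaNum τ (α s) / thetaDen τ (α s))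
include hτ hα hζ

lemma adjugate_Psi_zero :
    (Psi τ z ζ α).adjugate 0 = dFactor τ z α 0 1 2 3 • adjVector τ z ζ α 0 1 2 3 := by
  have h1 : theta1 τ (α 1) ≠ 0 := left_ne_zero_of_mul (hα 1)
  have h3 : theta3 τ (α 1) ≠ 0 := right_ne_zero_of_mul (hα 1)
  have hPsi : Psi τ z ζ α = Matrix.of ![fun s => aEntry τ z (α s), fun s => bEntry τ z (α s),
      (fun s => I * ζ s) * fun s => aEntry τ z (α s),
      (fun s => I * ζ s) * fun s => bEntry τ z (α s)] := rfl
  rw [hPsi, adjugate_zero_of_proportional_rows]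
  simp only [hζ, minor_bEntry hτ z (hα 1) (hα 2) (hα 3), minor_aEntry hτ z (hα 1) (hα 2) (hα 3),
    quotient_sub_mul_minor hτ z (hα 1) (hα 2) (hα 3)]
  have hε : leviCivita 0 1 2 3 = 1 := by decide
  ext r
  simp only [dFactor, hε, adjVector, sum_univ_erase_zero, prod_univ_erase_zero, hζ, Pi.smul_apply,
    smul_eq_mul, Int.cast_one]
  generalize thetaNum τ (α 1) / thetaDen τ (α 1) = w
  simp only [thetaDen, aEntry, bEntry]
  generalize z / 2 = y
  fin_cases r <;>
    simp only [Fin.zero_eta, Fin.mk_one, Fin.reduceFinMk, Matrix.cons_val_zero,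
      Matrix.cons_val_one, Matrix.cons_val, neg_mul, neg_neg, mul_neg, one_mul] <;>
    field_simp
  all_goals ring

lemma adjugate_transpose_col_Psi {i j k l : Fin 4} (hijkl : [i, j, k, l].Nodup) :
    (Psi τ z ζ α).adjugate.transpose.col i =
      dFactor τ z α i j k l • adjVector τ z ζ α i j k l := by
  have hinj : Function.Injective ![i, j, k, l] := by
    rw [← List.nodup_ofFn]
    simpa using hijkl
  obtain ⟨σ, rfl, rfl, rfl, rfl⟩ :
      ∃ σ : Equiv.Perm (Fin 4), σ 0 = i ∧ σ 1 = j ∧ σ 2 = k ∧ σ 3 = l :=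
    ⟨Equiv.ofBijective _ (Finite.injective_iff_bijective.1 hinj), rfl, rfl, rfl, rfl⟩
  have hdFactor : dFactor τ z α (σ 0) (σ 1) (σ 2) (σ 3) =
      (Equiv.Perm.sign σ : ℤ) * dFactor τ z (α ∘ σ) 0 1 2 3 := by
    simp [dFactor, sign_eq_leviCivita, show leviCivita 0 1 2 3 = 1 by decide, mul_assoc]
  ext r
  rw [Matrix.col_apply, Matrix.transpose_apply, adjugate_apply_perm, Psi_submatrix_perm,
    adjugate_Psi_zero hτ z (ζ := ζ ∘ σ) (α := α ∘ σ) (fun s => hα (σ s)) (fun s => hζ (σ s)),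
    Pi.smul_apply, Pi.smul_apply, adjVector_perm, hdFactor]
  simp only [smul_eq_mul, mul_assoc]

end AdjugatePsi

/-! ### The meromorphic function `θ₂ θ₄ / (θ₁ θ₃)` -/

/-- The constant `θ₂(0) θ₄(0) θ₁'(0)`, which governs the Wronskian of `θ₁ θ₃` and `θ₂ θ₄`. -/
noncomputable def thetaWronskian (τ : ℂ) : ℂ := theta2 τ 0 * theta4 τ 0 * deriv (theta1 τ) 0

/-- The constant `θ₁'(0) θ₃(0) / (2 θ₂(0) θ₄(0))`, which turns out to be the complete elliptic
integral. -/
noncomputable def thetaK (τ : ℂ) : ℂ :=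
  deriv (theta1 τ) 0 * theta3 τ 0 / (2 * (theta2 τ 0 * theta4 τ 0))

lemma thetaWronskian_eq {τ : ℂ} (h2 : theta2 τ 0 ≠ 0) (h3 : theta3 τ 0 ≠ 0) (h4 : theta4 τ 0 ≠ 0) :
    thetaWronskian τ = 2 * thetaK τ * (theta2 τ 0 ^ 2 * theta4 τ 0 ^ 2) / theta3 τ 0 := by
  rw [thetaWronskian, thetaK]
  field_simp

section ThetaFunctions

variable {τ : ℂ} (hτ : 0 < τ.im)
include hτ

lemma differentiable_theta3 : Differentiable ℂ (theta3 τ) :=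
  fun v => differentiableAt_jacobiTheta₂_fst v hτ

lemma differentiable_theta4 : Differentiable ℂ (theta4 τ) :=
  (differentiable_theta3 hτ).comp (differentiable_id.add_const _)

lemma differentiable_theta2 : Differentiable ℂ (theta2 τ) := by
  have h : Differentiable ℂ fun v => theta3 τ (v + τ / 2) :=
    (differentiable_theta3 hτ).comp (differentiable_id.add_const _)
  have h' : Differentiable ℂ fun v => cexp (Real.pi * I * (τ / 4 + v)) := by fun_prop
  exact h'.mul h

lemma differentiable_theta1 : Differentiable ℂ (theta1 τ) :=
  (differentiable_theta2 hτ).comp (differentiable_id.sub_const _)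

lemma differentiable_thetaNum : Differentiable ℂ (thetaNum τ) :=
  (differentiable_theta2 hτ).mul (differentiable_theta4 hτ)

lemma differentiable_thetaDen : Differentiable ℂ (thetaDen τ) :=
  (differentiable_theta1 hτ).mul (differentiable_theta3 hτ)

lemma deriv_thetaDen_mul_sub (v : ℂ) :
    deriv (thetaDen τ) v * thetaNum τ v - thetaDen τ v * deriv (thetaNum τ) v =
      thetaWronskian τ * theta3 τ (2 * v) := by
  have hlhs : HasDerivAt (fun u => thetaDen τ u * thetaNum τ v - thetaNum τ u * thetaDen τ v)
      (deriv (thetaDen τ) v * thetaNum τ v - deriv (thetaNum τ) v * thetaDen τ v) v :=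
    ((differentiable_thetaDen hτ v).hasDerivAt.mul_const _).sub
      ((differentiable_thetaNum hτ v).hasDerivAt.mul_const _)
  have hrhs : HasDerivAt (fun u => theta2 τ 0 * theta4 τ 0 * (theta1 τ (u - v) * theta3 τ (u + v)))
      (theta2 τ 0 * theta4 τ 0 * (deriv (theta1 τ) (v - v) * theta3 τ (v + v) +
        theta1 τ (v - v) * deriv (theta3 τ) (v + v))) v :=
    (((differentiable_theta1 hτ _).hasDerivAt.comp_sub_const v v).mul
      ((differentiable_theta3 hτ _).hasDerivAt.comp_add_const v v)).const_mul _
  simp only [thetaDen_mul_thetaNum_sub hτ] at hlhs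
  rw [mul_comm (thetaDen τ v), hlhs.unique hrhs, sub_self, theta1_zero, thetaWronskian, two_mul]
  ring

lemma hasDerivAt_thetaDen_div {v : ℂ} (hv : thetaNum τ v ≠ 0) :
    HasDerivAt (fun v => thetaDen τ v / thetaNum τ v)
      (thetaWronskian τ * theta3 τ (2 * v) / thetaNum τ v ^ 2) v := by
  rw [← deriv_thetaDen_mul_sub hτ]
  exact (differentiable_thetaDen hτ v).hasDerivAt.div (differentiable_thetaNum hτ v).hasDerivAt hv

lemma hasDerivAt_thetaNum_div {v : ℂ} (hv : thetaDen τ v ≠ 0) :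
    HasDerivAt (fun v => thetaNum τ v / thetaDen τ v)
      (-(thetaWronskian τ * theta3 τ (2 * v)) / thetaDen τ v ^ 2) v := by
  rw [← deriv_thetaDen_mul_sub hτ, neg_sub, mul_comm (thetaDen τ v), mul_comm _ (thetaNum τ v)]
  exact (differentiable_thetaNum hτ v).hasDerivAt.div (differentiable_thetaDen hτ v).hasDerivAt hv

/-- At a common zero `v`, the addition formula would make `θ₁(u - v) θ₃(u + v)` vanish for all
`u`. -/
lemma thetaNum_ne_zero_or_thetaDen_ne_zero (h2 : theta2 τ 0 ≠ 0) (h3 : theta3 τ 0 ≠ 0)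
    (h4 : theta4 τ 0 ≠ 0) (v : ℂ) : thetaNum τ v ≠ 0 ∨ thetaDen τ v ≠ 0 := by
  by_contra! hv
  have hmul (u : ℂ) : theta1 τ (u - v) * theta3 τ (u + v) = 0 := by
    have h := thetaDen_mul_thetaNum_sub hτ u v
    rw [hv.1, hv.2, mul_zero, mul_zero, sub_zero] at h
    exact (mul_eq_zero.1 h.symm).resolve_left (mul_ne_zero h2 h4)
  have hAnalytic {f : ℂ → ℂ} (hf : Differentiable ℂ f) : AnalyticOnNhd ℂ f Set.univ :=
    hf.differentiableOn.analyticOnNhd isOpen_univ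
  rcases AnalyticOnNhd.eq_zero_or_eq_zero_of_mul_eq_zero
      (hAnalytic ((differentiable_theta1 hτ).comp (differentiable_id.sub_const v)))
      (hAnalytic ((differentiable_theta3 hτ).comp (differentiable_id.add_const v)))
      (fun u _ => hmul u) isPreconnected_univ with h | h
  · apply h2
    rw [← theta1_add_half, ← add_sub_cancel_right (0 + 1 / 2) v]
    exact h _ trivial
  · apply h3
    simpa using h (-v) trivial

lemma theta2_zero_pow_add : theta2 τ 0 ^ 4 + theta4 τ 0 ^ 4 = theta3 τ 0 ^ 4 := by
  have h2 := theta2_mul_theta2 0 0 hτ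
  have h3 := theta3_mul_theta3 0 0 hτ
  have h4 := theta4_mul_theta4 0 0 hτ
  rw [← pow_two, add_zero, sub_zero] at h2 h3 h4
  rw [pow_mul _ 2 2, pow_mul _ 2 2, pow_mul _ 2 2, h2, h3, h4]
  ring

lemma theta3_two_mul_sq (v : ℂ) :
    theta2 τ 0 ^ 4 * theta4 τ 0 ^ 4 * theta3 τ 0 ^ 2 * theta3 τ (2 * v) ^ 2 =
      theta3 τ 0 ^ 4 * (thetaNum τ v ^ 4 + thetaDen τ v ^ 4) -
        2 * (theta2 τ 0 ^ 4 - theta4 τ 0 ^ 4) * thetaNum τ v ^ 2 * thetaDen τ v ^ 2 := by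
  have h2 := theta2_mul_theta2 0 0 hτ
  have h3 := theta3_mul_theta3 0 0 hτ
  have h4 := theta4_mul_theta4 0 0 hτ
  have hv1 := theta1_mul_theta1 v v hτ
  have hv2 := theta2_mul_theta2 v v hτ
  have hv3 := theta3_mul_theta3 v v hτ
  have hv4 := theta4_mul_theta4 v v hτ
  have h23 := theta3_mul_theta3 (2 * v) 0 hτ
  simp only [add_zero, sub_zero, sub_self, ← two_mul, ← pow_two, mul_zero]
    at h2 h3 h4 hv1 hv2 hv3 hv4 h23
  calc
    _ = (theta2 τ 0 ^ 2) ^ 2 * (theta4 τ 0 ^ 2) ^ 2 * (theta3 τ (2 * v) * theta3 τ 0) ^ 2 := by ring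
    _ = (theta3 τ 0 ^ 2) ^ 2 * ((theta2 τ v ^ 2 * theta4 τ v ^ 2) ^ 2 +
          (theta1 τ v ^ 2 * theta3 τ v ^ 2) ^ 2) -
        2 * ((theta2 τ 0 ^ 2) ^ 2 - (theta4 τ 0 ^ 2) ^ 2) *
          (theta2 τ v ^ 2 * theta4 τ v ^ 2) * (theta1 τ v ^ 2 * theta3 τ v ^ 2) := by
      rw [h2, h3, h4, hv1, hv2, hv3, hv4, h23]
      ring
    _ = _ := by
      simp only [thetaNum, thetaDen]
      ring

end ThetaFunctions

/-! ### Theta constants on the imaginary axis -/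

section ImaginaryTransformation

/-- The factor `(-i τ)^(-1/2)` of the transformation `τ ↦ -1 / τ` of the theta functions. -/
noncomputable def modularFactor (τ : ℂ) : ℂ := 1 / (-I * τ) ^ (1 / 2 : ℂ)

lemma modularFactor_ne_zero {τ : ℂ} (hτ : τ ≠ 0) : modularFactor τ ≠ 0 := by
  simp [modularFactor, cpow_eq_zero_iff, hτ]

lemma theta3_modular (τ v : ℂ) : theta3 τ v =
    modularFactor τ * cexp (-Real.pi * I * v ^ 2 / τ) * theta3 (-1 / τ) (v / τ) :=
  jacobiTheta₂_functional_equation v τ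

lemma theta1_modular {τ : ℂ} (hτ : τ ≠ 0) (v : ℂ) : theta1 τ v =
    I * modularFactor τ * cexp (-Real.pi * I * v ^ 2 / τ) * theta1 (-1 / τ) (v / τ) := by
  have harg : (v - 1 / 2 + τ / 2) / τ = v / τ + 1 / 2 + -1 / τ / 2 := by
    field_simp
    ring
  have hexp : cexp (Real.pi * I * (τ / 4 + (v - 1 / 2))) *
      cexp (-Real.pi * I * (v - 1 / 2 + τ / 2) ^ 2 / τ) * halfShift (-1 / τ) (v / τ) =
        cexp (-Real.pi * I * v ^ 2 / τ) := by
    rw [halfShift, ← Complex.exp_add, ← Complex.exp_add]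
    congr 1
    field_simp
    ring
  rw [theta1, theta2, ← theta3, theta3_modular, harg, theta3_add_half_add_half_period, ← hexp]
  ring

lemma theta3_zero_modular (τ : ℂ) : theta3 τ 0 = modularFactor τ * theta3 (-1 / τ) 0 := by
  simpa using theta3_modular τ 0

lemma theta2_zero_modular {τ : ℂ} (hτ : τ ≠ 0) :
    theta2 τ 0 = modularFactor τ * theta4 (-1 / τ) 0 := by
  have hexp : cexp (Real.pi * I * (τ / 4 + 0)) * cexp (-Real.pi * I * (τ / 2) ^ 2 / τ) = 1 := by
    rw [← Complex.exp_add, Complex.exp_eq_one_iff]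
    exact ⟨0, by field_simp; ring⟩
  have harg : τ / 2 / τ = 1 / 2 := by field_simp
  rw [theta2, zero_add, ← theta3, theta3_modular, ← theta3_add_half, zero_add, harg]
  linear_combination modularFactor τ * theta3 (-1 / τ) (1 / 2) * hexp

lemma theta4_zero_modular (τ : ℂ) : theta4 τ 0 = modularFactor τ * theta2 (-1 / τ) 0 := by
  rw [← theta3_add_half, ← theta3_neg, theta3_modular, theta2, ← theta3, ← mul_assoc]
  congr 2
  · congr 2
    ring
  · ring

lemma deriv_theta1_zero_modular {τ : ℂ} (hτ : 0 < τ.im) :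
    deriv (theta1 τ) 0 = I * modularFactor τ / τ * deriv (theta1 (-1 / τ)) 0 := by
  have hτ0 : τ ≠ 0 := by
    rintro rfl
    exact hτ.ne' zero_im
  have hτ' : 0 < (-1 / τ).im := by
    rw [neg_div, neg_im, one_div, inv_im, neg_div, neg_neg]
    exact div_pos hτ (normSq_pos.2 hτ0)
  have hfactor : DifferentiableAt ℂ
      (fun v => I * modularFactor τ * cexp (-Real.pi * I * v ^ 2 / τ)) 0 := by fun_prop
  have htheta : HasDerivAt (fun v => theta1 (-1 / τ) (v / τ))
      (deriv (theta1 (-1 / τ)) (0 / τ) * (1 / τ)) 0 :=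
    (differentiable_theta1 hτ' (0 / τ)).hasDerivAt.comp (h₂ := theta1 (-1 / τ)) 0
      ((hasDerivAt_id 0).div_const τ)
  rw [funext (theta1_modular hτ0), (hfactor.hasDerivAt.fun_mul htheta).deriv]
  simp only [zero_div, theta1_zero, mul_zero, zero_add, ne_eq, OfNat.ofNat_ne_zero,
    not_false_eq_true, zero_pow, Complex.exp_zero]
  ring

lemma thetaK_modular {τ : ℂ} (hτ : 0 < τ.im) : thetaK (-1 / τ) = -I * τ * thetaK τ := by
  have hτ0 : τ ≠ 0 := by
    rintro rfl
    exact hτ.ne' zero_im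
  have hc := modularFactor_ne_zero hτ0
  rw [thetaK, thetaK, deriv_theta1_zero_modular hτ, theta2_zero_modular hτ0, theta3_zero_modular τ,
    theta4_zero_modular τ]
  field_simp
  rw [I_sq]
  ring

end ImaginaryTransformation

section Conjugation

open scoped ComplexConjugate

lemma conj_theta3 (τ v : ℂ) : conj (theta3 τ v) = theta3 (-conj τ) (conj v) :=
  jacobiTheta₂_conj v τ

lemma conj_theta4 (τ v : ℂ) : conj (theta4 τ v) = theta4 (-conj τ) (conj v) := by
  rw [← theta3_add_half, conj_theta3, ← theta3_add_half]
  simp only [map_add, map_div₀, map_one, map_ofNat]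

lemma conj_theta2 (τ v : ℂ) : conj (theta2 τ v) = theta2 (-conj τ) (conj v) := by
  rw [← theta2_neg _ (conj v), theta2, theta2, ← theta3, ← theta3, map_mul, conj_theta3,
    ← theta3_neg, ← exp_conj]
  simp only [map_mul, map_add, map_div₀, conj_I, conj_ofReal, map_ofNat]
  congr 2 <;> ring

lemma conj_theta1 (τ v : ℂ) : conj (theta1 τ v) = theta1 (-conj τ) (conj v) := by
  rw [theta1, conj_theta2, theta1]
  simp only [map_sub, map_div₀, map_one, map_ofNat]

lemma conj_deriv_theta1_zero (τ : ℂ) :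
    conj (deriv (theta1 τ) 0) = deriv (theta1 (-conj τ)) 0 := by
  have h : theta1 (-conj τ) = conj ∘ theta1 τ ∘ conj := by
    funext v
    simp [conj_theta1]
  rw [h, deriv_conj_conj]
  simp

lemma conj_thetaNum (τ v : ℂ) : conj (thetaNum τ v) = thetaNum (-conj τ) (conj v) := by
  rw [thetaNum, map_mul, conj_theta2, conj_theta4, thetaNum]

lemma conj_thetaDen (τ v : ℂ) : conj (thetaDen τ v) = thetaDen (-conj τ) (conj v) := by
  rw [thetaDen, map_mul, conj_theta1, conj_theta3, thetaDen]

lemma conj_thetaK (τ : ℂ) : conj (thetaK τ) = thetaK (-conj τ) := by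
  simp only [thetaK, map_div₀, map_mul, conj_deriv_theta1_zero, conj_theta2, conj_theta3,
    conj_theta4, map_ofNat, map_zero]

end Conjugation

section Kernels

variable (a : UnitAddCircle) {t : ℝ}

lemma evenKernel_pos (ht : 0 < t) : 0 < HurwitzZeta.evenKernel a t := by
  induction a using QuotientAddGroup.induction_on with
  | H a =>
    have h := HurwitzZeta.hasSum_int_evenKernel a ht
    exact h.tsum_eq ▸ h.summable.tsum_pos (fun n => (Real.exp_pos _).le) 0 (Real.exp_pos _)

lemma cosKernel_pos (ht : 0 < t) : 0 < HurwitzZeta.cosKernel a t := by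
  have h := evenKernel_pos a (inv_pos.2 ht)
  rw [HurwitzZeta.evenKernel_functional_equation, one_div t⁻¹, inv_inv] at h
  exact pos_of_mul_pos_right h (by positivity)

lemma tendsto_cosKernel_atTop : Tendsto (HurwitzZeta.cosKernel a) atTop (𝓝 1) := by
  obtain ⟨p, hp, hO⟩ := HurwitzZeta.isBigO_atTop_cosKernel_sub a
  have hexp : Tendsto (fun t => Real.exp (-p * t)) atTop (𝓝 0) :=
    Real.tendsto_exp_atBot.comp (tendsto_id.const_mul_atTop_of_neg (neg_lt_zero.2 hp))
  simpa using (hO.trans_tendsto hexp).add_const 1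

lemma tendsto_evenKernel_atTop (ha : a ≠ 0) :
    Tendsto (HurwitzZeta.evenKernel a) atTop (𝓝 0) := by
  obtain ⟨p, hp, hO⟩ := HurwitzZeta.isBigO_atTop_evenKernel_sub a
  have hexp : Tendsto (fun t => Real.exp (-p * t)) atTop (𝓝 0) :=
    Real.tendsto_exp_atBot.comp (tendsto_id.const_mul_atTop_of_neg (neg_lt_zero.2 hp))
  simpa [ha] using hO.trans_tendsto hexp

end Kernels

section ImaginaryPeriod

open scoped ComplexConjugate

lemma theta3_eq_cosKernel (t x : ℝ) : theta3 (I * t) x = HurwitzZeta.cosKernel x t :=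
  (HurwitzZeta.cosKernel_def x t).symm

lemma theta4_eq_cosKernel (t x : ℝ) :
    theta4 (I * t) x = HurwitzZeta.cosKernel (x + 1 / 2 : ℝ) t := by
  rw [← theta3_add_half, ← theta3_eq_cosKernel]
  push_cast
  rfl

lemma theta2_zero_eq_evenKernel (t : ℝ) :
    theta2 (I * t) 0 = HurwitzZeta.evenKernel (1 / 2 : ℝ) t := by
  rw [theta2, HurwitzZeta.evenKernel_def]
  push_cast
  congr 2
  · linear_combination (Real.pi * t / 4 : ℂ) * I_sq
  · ring

lemma theta3_zero_eq_cosKernel (t : ℝ) : theta3 (I * t) 0 = HurwitzZeta.cosKernel 0 t := by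
  simpa using theta3_eq_cosKernel t 0

lemma theta4_zero_eq_cosKernel (t : ℝ) :
    theta4 (I * t) 0 = HurwitzZeta.cosKernel (1 / 2 : ℝ) t := by
  simpa only [ofReal_zero, zero_add] using theta4_eq_cosKernel t 0

lemma neg_conj_I_mul (t : ℝ) : -conj (I * t) = I * t := by simp

lemma ofReal_re_thetaNum (t x : ℝ) : ((thetaNum (I * t) x).re : ℂ) = thetaNum (I * t) x :=
  conj_eq_iff_re.1 (by rw [conj_thetaNum, neg_conj_I_mul, conj_ofReal])

lemma ofReal_re_thetaDen (t x : ℝ) : ((thetaDen (I * t) x).re : ℂ) = thetaDen (I * t) x :=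
  conj_eq_iff_re.1 (by rw [conj_thetaDen, neg_conj_I_mul, conj_ofReal])

lemma ofReal_re_thetaK (t : ℝ) : ((thetaK (I * t)).re : ℂ) = thetaK (I * t) :=
  conj_eq_iff_re.1 (by rw [conj_thetaK, neg_conj_I_mul])

lemma neg_one_div_I_mul (t : ℝ) : -1 / (I * (t : ℂ)) = I * (t⁻¹ : ℝ) := by
  rw [div_eq_mul_inv, mul_inv, inv_I, ofReal_inv]
  ring

variable {t : ℝ} (ht : 0 < t)
include ht

lemma I_mul_ofReal_im_pos : 0 < (I * (t : ℂ)).im := by simpa using ht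

lemma theta2_zero_ne_zero : theta2 (I * t) 0 ≠ 0 := by
  rw [theta2_zero_eq_evenKernel]
  exact ofReal_ne_zero.2 (evenKernel_pos _ ht).ne'

lemma theta3_zero_ne_zero : theta3 (I * t) 0 ≠ 0 := by
  rw [theta3_zero_eq_cosKernel]
  exact ofReal_ne_zero.2 (cosKernel_pos _ ht).ne'

lemma theta4_ofReal_ne_zero (x : ℝ) : theta4 (I * t) x ≠ 0 := by
  rw [theta4_eq_cosKernel]
  exact ofReal_ne_zero.2 (cosKernel_pos _ ht).ne'

lemma theta4_zero_ne_zero : theta4 (I * t) 0 ≠ 0 := by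
  simpa using theta4_ofReal_ne_zero ht 0

end ImaginaryPeriod

/-- The modulus `θ₂(0)² / θ₃(0)²` belonging to the period `i t`. -/
noncomputable def thetaModulus (t : ℝ) : ℝ :=
  (HurwitzZeta.evenKernel (1 / 2 : ℝ) t / HurwitzZeta.cosKernel 0 t) ^ 2

lemma ofReal_thetaModulus (t : ℝ) :
    (thetaModulus t : ℂ) = theta2 (I * t) 0 ^ 2 / theta3 (I * t) 0 ^ 2 := by
  rw [theta2_zero_eq_evenKernel, theta3_zero_eq_cosKernel, thetaModulus]
  push_cast
  rw [div_pow]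

lemma ofReal_thetaModulus_inv {t : ℝ} (ht : 0 < t) :
    (thetaModulus t⁻¹ : ℂ) = theta4 (I * t) 0 ^ 2 / theta3 (I * t) 0 ^ 2 := by
  have hc := modularFactor_ne_zero (mul_ne_zero I_ne_zero (ofReal_ne_zero.2 ht.ne'))
  rw [theta4_zero_modular, theta3_zero_modular, neg_one_div_I_mul, ofReal_thetaModulus, mul_pow,
    mul_pow, mul_div_mul_left _ _ (pow_ne_zero 2 hc)]

lemma thetaModulus_pos {t : ℝ} (ht : 0 < t) : 0 < thetaModulus t :=
  pow_pos (div_pos (evenKernel_pos _ ht) (cosKernel_pos _ ht)) 2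

lemma thetaModulus_sq_add {t : ℝ} (ht : 0 < t) :
    thetaModulus t ^ 2 + thetaModulus t⁻¹ ^ 2 = 1 := by
  have h3 := theta3_zero_ne_zero ht
  have h := theta2_zero_pow_add (I_mul_ofReal_im_pos ht)
  apply ofReal_injective
  push_cast
  rw [ofReal_thetaModulus, ofReal_thetaModulus_inv ht]
  field_simp
  exact h

lemma coModulus_thetaModulus {t : ℝ} (ht : 0 < t) :
    coModulus (thetaModulus t) = thetaModulus t⁻¹ := by
  rw [coModulus, ← thetaModulus_sq_add ht, add_sub_cancel_left,
    Real.sqrt_sq (thetaModulus_pos (inv_pos.2 ht)).le]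

lemma thetaModulus_sq_sub_coModulus_sq {t : ℝ} (ht : 0 < t) :
    (thetaModulus t : ℂ) ^ 2 - (coModulus (thetaModulus t) : ℂ) ^ 2 =
      (theta2 (I * t) 0 ^ 4 - theta4 (I * t) 0 ^ 4) / theta3 (I * t) 0 ^ 4 := by
  rw [coModulus_thetaModulus ht, ofReal_thetaModulus, ofReal_thetaModulus_inv ht]
  ring

lemma continuousOn_thetaModulus : ContinuousOn thetaModulus (Set.Ioi 0) :=
  ((HurwitzZeta.continuousOn_evenKernel _).div (HurwitzZeta.continuousOn_cosKernel _)
    fun _ ht => (cosKernel_pos _ ht).ne').pow 2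

lemma tendsto_thetaModulus_atTop : Tendsto thetaModulus atTop (𝓝 0) := by
  have hhalf : ((1 / 2 : ℝ) : UnitAddCircle) ≠ 0 := by
    rw [Ne, AddCircle.coe_eq_zero_iff]
    rintro ⟨n, hn⟩
    rw [zsmul_one] at hn
    have : 2 * n = 1 := by exact_mod_cast show 2 * (n : ℝ) = 1 by linear_combination 2 * hn
    omega
  have h := (tendsto_evenKernel_atTop _ hhalf).div (tendsto_cosKernel_atTop 0) one_ne_zero
  rw [zero_div] at h
  have h2 := h.pow 2
  rwa [zero_pow two_ne_zero] at h2

lemma tendsto_thetaModulus_nhdsGT_zero : Tendsto thetaModulus (𝓝[>] 0) (𝓝 1) := by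
  have hinv := tendsto_thetaModulus_atTop.comp tendsto_inv_nhdsGT_zero
  have hsqrt : Tendsto (fun t => √(1 - thetaModulus t⁻¹ ^ 2)) (𝓝[>] 0) (𝓝 1) := by
    simpa using ((hinv.pow 2).const_sub 1).sqrt
  refine hsqrt.congr' ?_
  filter_upwards [self_mem_nhdsWithin] with t ht
  rw [← thetaModulus_sq_add ht, add_sub_cancel_right, Real.sqrt_sq (thetaModulus_pos ht).le]

lemma exists_thetaModulus_eq {k : ℝ} (h0 : 0 < k) (h1 : k < 1) :
    ∃ t : ℝ, 0 < t ∧ thetaModulus t = k := by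
  have hle : 𝓝[>] (0 : ℝ) ≤ 𝓟 (Set.Ioi 0) := inf_le_right
  exact isPreconnected_Ioi.intermediate_value_Ioo (le_principal_iff.2 (Ioi_mem_atTop 0)) hle
    continuousOn_thetaModulus tendsto_thetaModulus_atTop tendsto_thetaModulus_nhdsGT_zero ⟨h0, h1⟩

lemma tendsto_tsum_mul_exp_neg_mul {ι : Type*} {c : ι → ℂ} {a : ι → ℝ} (ha : ∀ n, 0 ≤ a n)
    (hsum : Summable fun n => ‖c n‖ * Real.exp (-a n)) :
    Tendsto (fun t : ℝ => ∑' n, c n * Real.exp (-(a n * t))) atTop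
      (𝓝 (∑' n, {n | a n = 0}.indicator c n)) := by
  refine tendsto_tsum_of_dominated_convergence hsum (fun n => ?_) ?_
  · rcases (ha n).eq_or_lt with h0 | hpos
    · simp [← h0]
    · have hlim : Tendsto (fun t : ℝ => Real.exp (-(a n * t))) atTop (𝓝 0) :=
        Real.tendsto_exp_neg_atTop_nhds_zero.comp (tendsto_id.const_mul_atTop hpos)
      simpa [hpos.ne'] using ((continuous_ofReal.tendsto 0).comp hlim).const_mul (c n)
  · filter_upwards [eventually_ge_atTop 1] with t ht n
    rw [norm_mul, norm_real, Real.norm_of_nonneg (Real.exp_pos _).le]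
    gcongr
    exact le_mul_of_one_le_right (ha n) ht

lemma jacobiTheta₂_add_half_period (t x : ℝ) :
    jacobiTheta₂ (x + I * t / 2) (I * t) = ∑' n : ℤ, cexp ((2 * Real.pi * n * x : ℝ) * I) *
      Real.exp (-(Real.pi * (n * (n + 1) : ℤ) * t)) := by
  refine tsum_congr fun n => ?_
  rw [jacobiTheta₂_term, ofReal_exp, ← Complex.exp_add]
  congr 1
  push_cast
  linear_combination (Real.pi * n * (n + 1) * t : ℂ) * I_mul_I

lemma summable_exp_neg_pi_mul_pronic :
    Summable fun n : ℤ => Real.exp (-(Real.pi * (n * (n + 1) : ℤ))) := by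
  refine (((summable_jacobiTheta₂_term_iff (I / 2) I).2 (by simp)).norm).congr fun n => ?_
  rw [jacobiTheta₂_term, norm_exp]
  congr 1
  have : (2 * Real.pi * I * n * (I / 2) + Real.pi * I * n ^ 2 * I : ℂ) =
      ((-(Real.pi * (n * (n + 1) : ℤ)) : ℝ) : ℂ) := by
    push_cast
    linear_combination (Real.pi * n * (n + 1) : ℂ) * I_mul_I
  rw [this, ofReal_re]

lemma tendsto_jacobiTheta₂_add_half_period (x : ℝ) :
    Tendsto (fun t : ℝ => jacobiTheta₂ (x + I * t / 2) (I * t)) atTop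
      (𝓝 (1 + cexp (-(2 * Real.pi * x : ℝ) * I))) := by
  have hnn (n : ℤ) : 0 ≤ n * (n + 1) := by
    rcases le_or_gt 0 n with h | h
    · positivity
    · exact mul_nonneg_of_nonpos_of_nonpos h.le (by omega)
  have hzero : {n : ℤ | Real.pi * (n * (n + 1) : ℤ) = 0} = (({0, -1} : Finset ℤ) : Set ℤ) := by
    ext n
    rw [Set.mem_ofPred_eq, mul_eq_zero_iff_left Real.pi_ne_zero, Int.cast_eq_zero, mul_eq_zero,
      add_eq_zero_iff_eq_neg, Finset.mem_coe, Finset.mem_insert, Finset.mem_singleton]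
  simp only [jacobiTheta₂_add_half_period]
  convert tendsto_tsum_mul_exp_neg_mul
    (c := fun n : ℤ => cexp ((2 * Real.pi * n * x : ℝ) * I))
    (fun n => mul_nonneg Real.pi_pos.le (Int.cast_nonneg (hnn n))) ?_ using 2
  · rw [hzero, ← sum_eq_tsum_indicator]
    simp
  · simpa only [norm_exp_ofReal_mul_I, one_mul] using summable_exp_neg_pi_mul_pronic

lemma one_add_exp_mul_I_ne_zero {x : ℝ} (hx : |x| < 1 / 2) :
    1 + cexp (-(2 * Real.pi * x : ℝ) * I) ≠ 0 := by
  have hcos : Real.cos (Real.pi * x) ≠ 0 := by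
    refine (Real.cos_pos_of_mem_Ioo ⟨?_, ?_⟩).ne' <;> nlinarith [Real.pi_pos, abs_lt.1 hx]
  have hfactor : 1 + cexp (-(2 * Real.pi * x : ℝ) * I) =
      2 * Real.cos (Real.pi * x) * cexp (-(Real.pi * x : ℝ) * I) := by
    rw [ofReal_cos, two_cos, add_mul, ← Complex.exp_add, ← Complex.exp_add]
    push_cast
    ring_nf
    rw [Complex.exp_zero, add_comm]
  rw [hfactor]
  exact mul_ne_zero (mul_ne_zero two_ne_zero (ofReal_ne_zero.2 hcos)) (Complex.exp_ne_zero _)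

lemma theta2_two_mul_eq_zero {t : ℝ} (ht : 0 < t) {x : ℝ} (h : theta2 (I * t) x = 0) :
    theta2 (I * (2 * t : ℝ)) x = 0 := by
  have hmul := theta2_mul_theta2 (x : ℂ) 0 (I_mul_ofReal_im_pos ht)
  rw [h, zero_mul, add_zero, sub_zero,
    show 2 * (I * (t : ℂ)) = I * (2 * t : ℝ) by push_cast; ring] at hmul
  have h3 : theta3 (I * (2 * t : ℝ)) x ≠ 0 := by
    rw [theta3_eq_cosKernel]
    exact ofReal_ne_zero.2 (cosKernel_pos _ (by positivity)).ne'
  apply (mul_eq_zero.1 _).resolve_left (mul_ne_zero two_ne_zero h3)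
  linear_combination -hmul

-- A zero would persist under `t ↦ 2 t`, against the behaviour of `θ₂` as `t → ∞`.
lemma theta2_ofReal_ne_zero {t : ℝ} (ht : 0 < t) {x : ℝ} (hx : |x| < 1 / 2) :
    theta2 (I * t) x ≠ 0 := by
  intro h
  have hzero (n : ℕ) : theta2 (I * (2 ^ n * t : ℝ)) x = 0 := by
    induction n with
    | zero => simpa using h
    | succ n ih =>
      have := theta2_two_mul_eq_zero (by positivity) ih
      rwa [← mul_assoc, ← pow_succ'] at this
  have hlim := (tendsto_jacobiTheta₂_add_half_period x).comp
    ((tendsto_pow_atTop_atTop_of_one_lt (one_lt_two (α := ℝ))).atTop_mul_const ht)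
  have hconst := hlim.congr fun n => (mul_eq_zero.1 (hzero n)).resolve_left (Complex.exp_ne_zero _)
  exact one_add_exp_mul_I_ne_zero hx (tendsto_nhds_unique tendsto_const_nhds hconst).symm

/-! ### Complete elliptic integrals as theta constants -/

section EllipticIntegral

variable {k : ℝ}

lemma one_sub_mul_sin_sq_pos (hk : k ^ 2 < 1) (u : ℝ) : 0 < 1 - k ^ 2 * Real.sin u ^ 2 := by
  nlinarith [Real.sin_sq_le_one u, sq_nonneg k]

lemma continuous_ellipticK_integrand (hk : k ^ 2 < 1) :
    Continuous fun u : ℝ => 1 / √(1 - k ^ 2 * Real.sin u ^ 2) :=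
  continuous_const.div (by fun_prop) fun u => (Real.sqrt_pos.2 (one_sub_mul_sin_sq_pos hk u)).ne'

lemma ellipticK_pos (hk : k ^ 2 < 1) : 0 < ellipticK k :=
  intervalIntegral.intervalIntegral_pos_of_pos
    ((continuous_ellipticK_integrand hk).intervalIntegrable _ _)
    (fun u => one_div_pos.2 (Real.sqrt_pos.2 (one_sub_mul_sin_sq_pos hk u))) (by positivity)

lemma sin_two_mul_arctan (x : ℝ) : Real.sin (2 * Real.arctan x) = 2 * x / (1 + x ^ 2) := by
  have h : (0 : ℝ) < 1 + x ^ 2 := by positivity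
  rw [Real.sin_two_mul, Real.sin_arctan, Real.cos_arctan]
  field_simp
  rw [Real.sq_sqrt h.le]

lemma one_sub_mul_sin_two_mul_arctan_sq (k x : ℝ) :
    1 - k ^ 2 * Real.sin (2 * Real.arctan x) ^ 2 =
      (x ^ 4 - 2 * (2 * k ^ 2 - 1) * x ^ 2 + 1) / (1 + x ^ 2) ^ 2 := by
  rw [sin_two_mul_arctan]
  field_simp
  ring

-- Substitute `u = 2 arctan x`.
lemma ellipticK_eq_of_hasDerivAt (hk : k ^ 2 < 1) {a κ : ℝ} {x R : ℝ → ℝ}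
    (hx : ∀ v ∈ Set.uIcc 0 a, HasDerivAt x (2 * κ * R v) v) (hR : ∀ v ∈ Set.uIcc 0 a, 0 ≤ R v)
    (hRsq : ∀ v ∈ Set.uIcc 0 a, R v ^ 2 = x v ^ 4 - 2 * (2 * k ^ 2 - 1) * x v ^ 2 + 1)
    (hx0 : x 0 = 0) (hxa : x a = 1) : ellipticK k = 4 * κ * a := by
  have hcont := continuous_ellipticK_integrand hk
  have hderiv : ∀ v ∈ Set.uIcc 0 a,
      HasDerivAt (fun v => ∫ u in (0 : ℝ)..2 * Real.arctan (x v),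
        1 / √(1 - k ^ 2 * Real.sin u ^ 2)) (4 * κ) v := by
    intro v hv
    have hsqrt : √(1 - k ^ 2 * Real.sin (2 * Real.arctan (x v)) ^ 2) = R v / (1 + x v ^ 2) := by
      rw [one_sub_mul_sin_two_mul_arctan_sq, ← hRsq v hv, ← div_pow,
        Real.sqrt_sq (div_nonneg (hR v hv) (by positivity))]
    have hR0 : R v ≠ 0 := fun h0 => by
      have hpos := Real.sqrt_pos.2 (one_sub_mul_sin_sq_pos hk (2 * Real.arctan (x v)))
      rw [hsqrt, h0, zero_div] at hpos
      exact hpos.false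
    refine ((hcont.integral_hasStrictDerivAt 0 _).hasDerivAt.comp v
      ((hx v hv).arctan.const_mul 2)).congr_deriv ?_
    rw [hsqrt]
    field_simp
    ring
  have hint := intervalIntegral.integral_eq_sub_of_hasDerivAt hderiv
    (continuous_const.intervalIntegrable _ _)
  rw [hx0, hxa, Real.arctan_zero, Real.arctan_one, mul_zero, intervalIntegral.integral_same,
    show 2 * (Real.pi / 4) = Real.pi / 2 by ring, sub_zero, intervalIntegral.integral_const,
    sub_zero, smul_eq_mul] at hint
  rw [ellipticK, ← hint, mul_comm]

end EllipticIntegral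

/-- The values of `θ₁ θ₃ / (θ₂ θ₄)` on the real axis, for the period `i t`. -/
noncomputable def thetaQuot (t v : ℝ) : ℝ := (thetaDen (I * t) v).re / (thetaNum (I * t) v).re

/-- The derivative of `thetaQuot` divided by `2 * thetaK`, in a form that shows that it is
nonnegative. -/
noncomputable def thetaQuotRoot (t v : ℝ) : ℝ :=
  HurwitzZeta.evenKernel (1 / 2 : ℝ) t ^ 2 * HurwitzZeta.cosKernel (1 / 2 : ℝ) t ^ 2 *
    HurwitzZeta.cosKernel (2 * v : ℝ) t /
      (HurwitzZeta.cosKernel 0 t * (thetaNum (I * t) v).re ^ 2)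

lemma ofReal_thetaQuot (t v : ℝ) :
    (thetaQuot t v : ℂ) = thetaDen (I * t) v / thetaNum (I * t) v := by
  rw [thetaQuot, ofReal_div, ofReal_re_thetaDen, ofReal_re_thetaNum]

lemma ofReal_thetaQuotRoot (t v : ℝ) :
    (thetaQuotRoot t v : ℂ) =
      theta2 (I * t) 0 ^ 2 * theta4 (I * t) 0 ^ 2 * theta3 (I * t) (2 * v) /
        (theta3 (I * t) 0 * thetaNum (I * t) v ^ 2) := by
  have h3 := theta3_eq_cosKernel t (2 * v)
  rw [ofReal_mul, ofReal_ofNat] at h3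
  rw [theta2_zero_eq_evenKernel, theta4_zero_eq_cosKernel, theta3_zero_eq_cosKernel, h3,
    ← ofReal_re_thetaNum, thetaQuotRoot]
  push_cast
  rfl

section Period

variable {t : ℝ} (ht : 0 < t)
include ht

lemma thetaQuotRoot_nonneg (v : ℝ) : 0 ≤ thetaQuotRoot t v := by
  have h3 := cosKernel_pos 0 ht
  have h3v := cosKernel_pos (2 * v : ℝ) ht
  unfold thetaQuotRoot
  positivity

lemma thetaNum_ofReal_ne_zero {v : ℝ} (hv : |v| < 1 / 2) : thetaNum (I * t) v ≠ 0 :=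
  mul_ne_zero (theta2_ofReal_ne_zero ht hv) (theta4_ofReal_ne_zero ht v)

lemma hasDerivAt_thetaQuot {v : ℝ} (hv : |v| < 1 / 2) :
    HasDerivAt (thetaQuot t) (2 * (thetaK (I * t)).re * thetaQuotRoot t v) v := by
  have h := (hasDerivAt_thetaDen_div (I_mul_ofReal_im_pos ht)
    (thetaNum_ofReal_ne_zero ht hv)).real_of_complex
  have hquot : (fun x : ℝ => (thetaDen (I * t) x / thetaNum (I * t) x).re) = thetaQuot t := by
    funext x
    rw [← ofReal_thetaQuot, ofReal_re]
  rw [hquot] at h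
  refine h.congr_deriv ?_
  rw [← ofReal_re (2 * (thetaK (I * t)).re * thetaQuotRoot t v)]
  congr 1
  push_cast
  rw [ofReal_re_thetaK, ofReal_thetaQuotRoot, thetaWronskian_eq (theta2_zero_ne_zero ht)
    (theta3_zero_ne_zero ht) (theta4_zero_ne_zero ht)]
  have := thetaNum_ofReal_ne_zero ht hv
  have := theta3_zero_ne_zero ht
  field_simp

lemma thetaQuotRoot_sq {v : ℝ} (hv : |v| < 1 / 2) :
    thetaQuotRoot t v ^ 2 =
      thetaQuot t v ^ 4 - 2 * (2 * thetaModulus t ^ 2 - 1) * thetaQuot t v ^ 2 + 1 := by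
  have hN := thetaNum_ofReal_ne_zero ht hv
  have h3 := theta3_zero_ne_zero ht
  have hmod : 2 * (thetaModulus t : ℂ) ^ 2 - 1 =
      (theta2 (I * t) 0 ^ 4 - theta4 (I * t) 0 ^ 4) / theta3 (I * t) 0 ^ 4 := by
    have hsum : (thetaModulus t : ℂ) ^ 2 + (thetaModulus t⁻¹ : ℂ) ^ 2 = 1 := by
      exact_mod_cast thetaModulus_sq_add ht
    rw [← thetaModulus_sq_sub_coModulus_sq ht, coModulus_thetaModulus ht]
    linear_combination hsum
  apply ofReal_injective
  push_cast
  rw [hmod, ofReal_thetaQuotRoot, ofReal_thetaQuot]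
  field_simp
  linear_combination theta3_two_mul_sq (I_mul_ofReal_im_pos ht) (v : ℂ)

lemma thetaQuot_quarter : thetaQuot t (1 / 4) = 1 := by
  have hN := thetaNum_ofReal_ne_zero ht (v := 1 / 4) (by rw [abs_of_pos] <;> norm_num)
  have h1 : theta1 (I * t) (1 / 4) = theta2 (I * t) (1 / 4) := by
    rw [theta1, ← theta2_neg]
    norm_num
  have h3 : theta3 (I * t) (1 / 4) = theta4 (I * t) (1 / 4) := by
    rw [← theta4_neg, ← theta3_add_half]
    norm_num
  apply ofReal_injective
  rw [ofReal_thetaQuot, ofReal_one, div_eq_one_iff_eq hN, thetaDen, thetaNum]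
  push_cast
  rw [h1, h3]

lemma thetaModulus_sq_lt_one : thetaModulus t ^ 2 < 1 := by
  nlinarith [thetaModulus_sq_add ht, thetaModulus_pos (inv_pos.2 ht)]

lemma ellipticK_thetaModulus : (ellipticK (thetaModulus t) : ℂ) = thetaK (I * t) := by
  have hsmall : ∀ v ∈ Set.uIcc (0 : ℝ) (1 / 4), |v| < 1 / 2 := by
    rw [Set.uIcc_of_le (by norm_num)]
    exact fun v hv => abs_lt.2 ⟨by linarith [hv.1], by linarith [hv.2]⟩
  have hzero : thetaQuot t 0 = 0 := by simp [thetaQuot, thetaDen, theta1_zero]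
  rw [ellipticK_eq_of_hasDerivAt (thetaModulus_sq_lt_one ht)
    (fun v hv => hasDerivAt_thetaQuot ht (hsmall v hv)) (fun v _ => thetaQuotRoot_nonneg ht v)
    (fun v hv => thetaQuotRoot_sq ht (hsmall v hv)) hzero (thetaQuot_quarter ht)]
  push_cast
  rw [ofReal_re_thetaK]
  ring

lemma thetaK_ne_zero : thetaK (I * t) ≠ 0 := by
  rw [← ellipticK_thetaModulus ht]
  exact ofReal_ne_zero.2 (ellipticK_pos (thetaModulus_sq_lt_one ht)).ne'

lemma period_thetaModulus : period (thetaModulus t) = I * t := by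
  rw [period, coModulus_thetaModulus ht, ellipticK_thetaModulus ht,
    ellipticK_thetaModulus (inv_pos.2 ht), ← neg_one_div_I_mul,
    thetaK_modular (I_mul_ofReal_im_pos ht), ← mul_assoc,
    mul_div_cancel_right₀ _ (thetaK_ne_zero ht)]
  linear_combination -(I * t) * I_sq

end Period

/-! ### Inversion of the Abel map -/

lemma eventually_eq_of_hasDerivAt_zero {E : Type*} [NormedAddCommGroup E] [NormedSpace ℝ E]
    {f : ℝ → E} {t₀ : ℝ} {c : E} (hf : ∀ᶠ t in 𝓝[>] t₀, HasDerivAt f 0 t)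
    (hlim : Tendsto f (𝓝[>] t₀) (𝓝 c)) : ∀ᶠ t in 𝓝[>] t₀, f t = c := by
  obtain ⟨b, hb, hsub⟩ := mem_nhdsGT_iff_exists_Ioo_subset.1 hf
  filter_upwards [Ioo_mem_nhdsGT hb] with t ht
  refine tendsto_nhds_unique (tendsto_const_nhds.congr' ?_) hlim
  filter_upwards [Ioo_mem_nhdsGT hb] with s hs
  exact isOpen_Ioo.is_const_of_deriv_eq_zero isPreconnected_Ioo
    (fun r hr => (hsub hr).differentiableAt.differentiableWithinAt)
    (fun r hr => (hsub hr).deriv) ht hs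

lemma exists_local_inverse {φ ω : ℂ → ℂ} {v₀ : ℂ} (hφ : ∀ᶠ v in 𝓝 v₀, HasDerivAt φ (ω v) v)
    (hω : ContinuousAt ω v₀) (hω₀ : ω v₀ ≠ 0) :
    ∃ ψ : ℂ → ℂ, Tendsto ψ (𝓝 (φ v₀)) (𝓝 v₀) ∧
      ∀ᶠ x in 𝓝 (φ v₀), φ (ψ x) = x ∧ HasDerivAt ψ (ω (ψ x))⁻¹ x := by
  have hstrict := (hasStrictDerivAt_of_hasDerivAt_of_continuousAt hφ hω).hasStrictFDerivAt_equiv hω₀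
  let e := hstrict.toOpenPartialHomeomorph φ
  have he : (e : ℂ → ℂ) = φ := hstrict.toOpenPartialHomeomorph_coe
  have hsource : v₀ ∈ e.source := hstrict.mem_toOpenPartialHomeomorph_source
  have htarget : φ v₀ ∈ e.target := he ▸ e.map_source hsource
  have hψ : Tendsto e.symm (𝓝 (φ v₀)) (𝓝 v₀) := by
    simpa only [← he, e.left_inv hsource] using (e.continuousAt_symm htarget).tendsto
  refine ⟨e.symm, hψ, ?_⟩
  filter_upwards [e.open_target.mem_nhds htarget, hψ.eventually hφ,
    (hω.tendsto.comp hψ).eventually_ne hω₀] with x hx hd hne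
  exact ⟨by simpa only [he] using e.right_inv hx, e.hasDerivAt_symm hx hne (by rwa [he])⟩

-- Both `(x, y)` and `(φ ∘ a, ω ∘ a)` solve `dx = y da` on `y² = P x`; the limit of `y` selects the
-- branch of the square root.
lemma eventually_eq_comp_of_hasDerivAt {φ ω P : ℂ → ℂ} {v₀ : ℂ}
    (hφ : ∀ᶠ v in 𝓝 v₀, HasDerivAt φ (ω v) v) (hω : ContinuousAt ω v₀) (hω₀ : ω v₀ ≠ 0)
    (hP : ∀ᶠ v in 𝓝 v₀, ω v ^ 2 = P (φ v)) {t₀ : ℝ} {x y a g : ℝ → ℂ}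
    (hx : ∀ᶠ t in 𝓝[>] t₀, HasDerivAt x (g t * y t) t)
    (ha : ∀ᶠ t in 𝓝[>] t₀, HasDerivAt a (g t) t)
    (hy : ∀ᶠ t in 𝓝[>] t₀, y t ^ 2 = P (x t))
    (hx₀ : Tendsto x (𝓝[>] t₀) (𝓝 (φ v₀))) (hy₀ : Tendsto y (𝓝[>] t₀) (𝓝 (ω v₀)))
    (ha₀ : Tendsto a (𝓝[>] t₀) (𝓝 v₀)) :
    ∀ᶠ t in 𝓝[>] t₀, x t = φ (a t) ∧ y t = ω (a t) := by
  obtain ⟨ψ, hψ, hinv⟩ := exists_local_inverse hφ hω hω₀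
  have hψx := hψ.comp hx₀
  have hωψx := hω.tendsto.comp hψx
  have hsum : ∀ᶠ t in 𝓝[>] t₀, y t + ω (ψ (x t)) ≠ 0 :=
    (hy₀.add hωψx).eventually_ne (by simpa [← two_mul] using hω₀)
  have hsheet : ∀ᶠ t in 𝓝[>] t₀, y t = ω (ψ (x t)) := by
    filter_upwards [hy, hsum, hx₀.eventually hinv, hψx.eventually hP] with t hyt hne hinvt hPt
    have hPx : ω (ψ (x t)) ^ 2 = P (x t) := by simpa only [Function.comp_apply, hinvt.1] using hPt
    have hfactor : (y t - ω (ψ (x t))) * (y t + ω (ψ (x t))) = 0 := by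
      linear_combination hyt - hPx
    exact sub_eq_zero.1 ((mul_eq_zero.1 hfactor).resolve_right hne)
  have hderiv : ∀ᶠ t in 𝓝[>] t₀, HasDerivAt (fun t => a t - ψ (x t)) 0 t := by
    filter_upwards [hx, ha, hsheet, hx₀.eventually hinv, hωψx.eventually_ne hω₀]
      with t hxt hat hyt hinvt (hne : ω (ψ (x t)) ≠ 0)
    refine (hat.sub (hinvt.2.comp t hxt)).congr_deriv ?_
    rw [hyt]
    field_simp
    ring
  have hlim : Tendsto (fun t => a t - ψ (x t)) (𝓝[>] t₀) (𝓝 0) := by simpa using ha₀.sub hψx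
  filter_upwards [eventually_eq_of_hasDerivAt_zero hderiv hlim, hsheet, hx₀.eventually hinv]
    with t hat hyt hinvt
  rw [sub_eq_zero.1 hat]
  exact ⟨hinvt.1.symm, hyt⟩

/-- The polynomial `q` for which the curve reads `y² = q(x)` in the coordinates `x = i ζ` and
`y = 4 i η`. -/
noncomputable def curveQuartic (k : ℝ) (x : ℂ) : ℂ :=
  4 * (ellipticK k : ℂ) ^ 2 *
    (x ^ 4 - 2 * ((k : ℂ) ^ 2 - (coModulus k : ℂ) ^ 2) * x ^ 2 + 1)

lemma OnCurve.sq_eq_curveQuartic {k : ℝ} {ζ η : ℂ} (h : OnCurve k ζ η) :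
    (4 * I * η) ^ 2 = curveQuartic k (I * ζ) := by
  rw [OnCurve] at h
  rw [curveQuartic]
  linear_combination 16 * h + (16 * η ^ 2 - 4 * (ellipticK k : ℂ) ^ 2 * ((I ^ 2 - 1) * ζ ^ 4 -
    2 * ((k : ℂ) ^ 2 - (coModulus k : ℂ) ^ 2) * ζ ^ 2)) * I_sq

lemma curveQuartic_inv (k : ℝ) {x : ℂ} (hx : x ≠ 0) :
    curveQuartic k x⁻¹ = curveQuartic k x / x ^ 4 := by
  simp only [curveQuartic]
  field_simp
  ring

lemma sq_add_coModulus_sq {k : ℝ} (hk : k ^ 2 ≤ 1) :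
    (k : ℂ) ^ 2 + (coModulus k : ℂ) ^ 2 = 1 := by
  have h : k ^ 2 + coModulus k ^ 2 = 1 := by
    rw [coModulus, Real.sq_sqrt (by linarith), add_sub_cancel]
  exact_mod_cast h

/-- Up to a factor, the derivative with respect to `ζ` of the right-hand side of the equation of
the curve. -/
noncomputable def curveCubic (k : ℝ) (ζ : ℂ) : ℂ :=
  4 * ζ ^ 3 + 4 * ((k : ℂ) ^ 2 - (coModulus k : ℂ) ^ 2) * ζ

lemma OnCurve.curveCubic_ne_zero {k : ℝ} (hk0 : k ≠ 0) (hk1 : k ^ 2 < 1) {z : ℂ}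
    (hz : OnCurve k z 0) : curveCubic k z ≠ 0 := by
  have hK : (ellipticK k : ℂ) ^ 2 / 4 ≠ 0 :=
    div_ne_zero (pow_ne_zero 2 (ofReal_ne_zero.2 (ellipticK_pos hk1).ne')) (by norm_num)
  have hk' : (coModulus k : ℂ) ≠ 0 := ofReal_ne_zero.2 (Real.sqrt_pos.2 (by linarith)).ne'
  have hquartic : z ^ 4 + 2 * ((k : ℂ) ^ 2 - (coModulus k : ℂ) ^ 2) * z ^ 2 + 1 = 0 := by
    refine (mul_eq_zero.1 ?_).resolve_left hK
    rw [OnCurve] at hz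
    linear_combination -hz
  intro h
  have hfactor : z * (z ^ 2 + ((k : ℂ) ^ 2 - (coModulus k : ℂ) ^ 2)) = 0 := by
    rw [curveCubic] at h
    linear_combination h / 4
  rcases mul_eq_zero.1 hfactor with h0 | h0
  · norm_num [h0] at hquartic
  · have hdisc : (2 * (k : ℂ) * coModulus k) ^ 2 = 0 := by
      linear_combination hquartic - (z ^ 2 + ((k : ℂ) ^ 2 - (coModulus k : ℂ) ^ 2)) * h0 +
        ((k : ℂ) ^ 2 + (coModulus k : ℂ) ^ 2 + 1) * sq_add_coModulus_sq hk1.le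
    exact pow_ne_zero 2 (mul_ne_zero (mul_ne_zero two_ne_zero (ofReal_ne_zero.2 hk0)) hk') hdisc

lemma intervalIntegrable_of_tendsto_nhdsLT {E : Type*} [NormedAddCommGroup E] {f : ℝ → E}
    {a b : ℝ} (hab : a < b) (hf : ContinuousOn f (Set.Ico a b)) {L : E}
    (hL : Tendsto f (𝓝[<] b) (𝓝 L)) : IntervalIntegrable f MeasureTheory.volume a b := by
  have hcont : ContinuousOn (Function.update f b L) (Set.uIcc a b) := by
    rw [Set.uIcc_of_le hab.le, continuousOn_update_iff, Set.Icc_sdiff_right]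
    refine ⟨hf, fun _ => ?_⟩
    rwa [nhdsWithin_Ico_eq_nhdsLT hab]
  refine hcont.intervalIntegrable.congr_uIoo fun s hs => ?_
  rw [Set.uIoo_of_le hab.le] at hs
  exact Function.update_of_ne hs.2.ne _ _

lemma tendsto_deriv_nhdsLT {E : Type*} [NormedAddCommGroup E] [NormedSpace ℝ E] {f : ℝ → E}
    {a b : ℝ} (hab : a < b) (hf : ContDiffOn ℝ 1 f (Set.Ioc a b)) :
    Tendsto (deriv f) (𝓝[<] b) (𝓝 (derivWithin f (Set.Ioc a b) b)) := by
  have hcont := hf.continuousOn_derivWithin (uniqueDiffOn_Ioc a b) le_rfl b ⟨hab, le_rfl⟩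
  have hle : 𝓝[<] b ≤ 𝓝[Set.Ioc a b] b := by
    rw [← nhdsWithin_Ioo_eq_nhdsLT hab]
    exact nhdsWithin_mono b Set.Ioo_subset_Ioc_self
  refine (hcont.tendsto.mono_left hle).congr' ?_
  filter_upwards [Ioo_mem_nhdsLT hab] with s hs
  exact derivWithin_of_mem_nhds (Ioc_mem_nhds hs.1 hs.2)

/-- The pullback of the differential `dζ / (4 η)` along a path `(ζ, η)`. -/
noncomputable def abelIntegrand (ζ η : ℝ → ℂ) (t : ℝ) : ℂ := deriv ζ t / (4 * η t)

/-- The value at the point with parameter `t` of the Abel map along a path `(ζ, η)`, when its value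
at the end of the path is `α`. -/
noncomputable def abelAlong (ζ η : ℝ → ℂ) (α : ℂ) (t : ℝ) : ℂ :=
  α - ∫ s in t..1, abelIntegrand ζ η s

lemma abelAlong_one (ζ η : ℝ → ℂ) (α : ℂ) : abelAlong ζ η α 1 = α := by simp [abelAlong]

namespace IsPathFromInfinity

variable {k : ℝ} {ζ η : ℝ → ℂ} {ζ₀ η₀ : ℂ} (h : IsPathFromInfinity k ζ η ζ₀ η₀)
include h

lemma hasDerivAt_zeta {t : ℝ} (ht : t ∈ Set.Ioo (0 : ℝ) 1) : HasDerivAt ζ (deriv ζ t) t :=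
  ((h.contDiffOn_zeta.differentiableOn one_ne_zero).differentiableAt
    (Ioc_mem_nhds ht.1 ht.2)).hasDerivAt

lemma hasDerivAt_eta {t : ℝ} (ht : t ∈ Set.Ioo (0 : ℝ) 1) : HasDerivAt η (deriv η t) t :=
  ((h.contDiffOn_eta.differentiableOn one_ne_zero).differentiableAt
    (Ioc_mem_nhds ht.1 ht.2)).hasDerivAt

lemma hasDerivAt_I_mul_zeta {t : ℝ} (ht : t ∈ Set.Ioo (0 : ℝ) 1) :
    HasDerivAt (fun t => I * ζ t) (abelIntegrand ζ η t * (4 * I * η t)) t := by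
  refine ((h.hasDerivAt_zeta ht).const_mul I).congr_deriv ?_
  have := h.eta_ne_zero t ht
  rw [abelIntegrand]
  field_simp

lemma continuousOn_abelIntegrand : ContinuousOn (abelIntegrand ζ η) (Set.Ioo 0 1) := by
  have hζ : ContinuousOn (deriv ζ) (Set.Ioo 0 1) :=
    (h.contDiffOn_zeta.mono Set.Ioo_subset_Ioc_self).continuousOn_deriv_of_isOpen isOpen_Ioo le_rfl
  have hη : ContinuousOn η (Set.Ioo 0 1) :=
    h.contDiffOn_eta.continuousOn.mono Set.Ioo_subset_Ioc_self
  exact hζ.div (continuousOn_const.mul hη) fun t ht =>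
    mul_ne_zero (by norm_num) (h.eta_ne_zero t ht)

lemma two_mul_eta_mul_deriv_eta {t : ℝ} (ht : t ∈ Set.Ioo (0 : ℝ) 1) :
    2 * η t * deriv η t = -((ellipticK k : ℂ) ^ 2 / 4 * curveCubic k (ζ t) * deriv ζ t) := by
  have hζ := h.hasDerivAt_zeta ht
  have hderiv : HasDerivAt (fun s => η s ^ 2 + (ellipticK k : ℂ) ^ 2 / 4 *
      (ζ s ^ 4 + 2 * ((k : ℂ) ^ 2 - (coModulus k : ℂ) ^ 2) * ζ s ^ 2 + 1)) _ t :=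
    ((h.hasDerivAt_eta ht).pow 2).add ((((hζ.pow 4).add ((hζ.pow 2).const_mul
      (2 * ((k : ℂ) ^ 2 - (coModulus k : ℂ) ^ 2)))).add_const 1).const_mul
        ((ellipticK k : ℂ) ^ 2 / 4))
  have hzero : (fun s => η s ^ 2 + (ellipticK k : ℂ) ^ 2 / 4 *
      (ζ s ^ 4 + 2 * ((k : ℂ) ^ 2 - (coModulus k : ℂ) ^ 2) * ζ s ^ 2 + 1)) =ᶠ[𝓝 t]
        fun _ => 0 := by
    filter_upwards [Ioc_mem_nhds ht.1 ht.2] with s hs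
    exact (h.onCurve s hs).symm
  have hunique := hderiv.unique ((hasDerivAt_const t (0 : ℂ)).congr_of_eventuallyEq hzero)
  rw [curveCubic]
  push_cast at hunique
  linear_combination hunique

-- If the path ends at a branch point, `dζ / η` is expressed through `dη`.
lemma exists_tendsto_abelIntegrand (hk0 : k ≠ 0) (hk1 : k ^ 2 < 1) :
    ∃ L, Tendsto (abelIntegrand ζ η) (𝓝[<] 1) (𝓝 L) := by
  have hone : (1 : ℝ) ∈ Set.Ioc (0 : ℝ) 1 := ⟨one_pos, le_rfl⟩
  have hle : 𝓝[<] (1 : ℝ) ≤ 𝓝[Set.Ioc 0 1] 1 := by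
    rw [← nhdsWithin_Ioo_eq_nhdsLT one_pos]
    exact nhdsWithin_mono 1 Set.Ioo_subset_Ioc_self
  have hζ := (h.contDiffOn_zeta.continuousOn 1 hone).tendsto.mono_left hle
  have hη := (h.contDiffOn_eta.continuousOn 1 hone).tendsto.mono_left hle
  by_cases hη1 : η 1 = 0
  · have hK : (ellipticK k : ℂ) ≠ 0 := ofReal_ne_zero.2 (ellipticK_pos hk1).ne'
    have hcubic := OnCurve.curveCubic_ne_zero hk0 hk1 (hη1 ▸ h.onCurve 1 hone)
    have hcubic_lim : Tendsto (fun t => curveCubic k (ζ t)) (𝓝[<] 1) (𝓝 (curveCubic k (ζ 1))) :=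
      ((hζ.pow 3).const_mul _).add (hζ.const_mul _)
    refine ⟨_, (((tendsto_deriv_nhdsLT one_pos h.contDiffOn_eta).const_mul (-2)).div
      (hcubic_lim.const_mul ((ellipticK k : ℂ) ^ 2))
      (mul_ne_zero (pow_ne_zero 2 hK) hcubic)).congr' ?_⟩
    filter_upwards [Ioo_mem_nhdsLT one_pos, hcubic_lim.eventually_ne hcubic] with t ht hne
    simp only [Pi.div_apply]
    rw [abelIntegrand, div_eq_div_iff (mul_ne_zero (pow_ne_zero 2 hK) hne)
      (mul_ne_zero (by norm_num) (h.eta_ne_zero t ht))]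
    linear_combination -4 * h.two_mul_eta_mul_deriv_eta ht
  · exact ⟨_, (tendsto_deriv_nhdsLT one_pos h.contDiffOn_zeta).div (hη.const_mul 4)
      (mul_ne_zero (by norm_num) hη1)⟩

lemma intervalIntegrable_abelIntegrand (hk0 : k ≠ 0) (hk1 : k ^ 2 < 1) {t : ℝ}
    (ht : t ∈ Set.Ioo (0 : ℝ) 1) :
    IntervalIntegrable (abelIntegrand ζ η) MeasureTheory.volume t 1 := by
  obtain ⟨L, hL⟩ := h.exists_tendsto_abelIntegrand hk0 hk1
  exact intervalIntegrable_of_tendsto_nhdsLT ht.2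
    (h.continuousOn_abelIntegrand.mono fun s hs => ⟨ht.1.trans_le hs.1, hs.2⟩) hL

lemma hasDerivAt_abelAlong (hk0 : k ≠ 0) (hk1 : k ^ 2 < 1) (α : ℂ) {t : ℝ}
    (ht : t ∈ Set.Ioo (0 : ℝ) 1) : HasDerivAt (abelAlong ζ η α) (abelIntegrand ζ η t) t := by
  have hcont := h.continuousOn_abelIntegrand
  have hderiv := (intervalIntegral.integral_hasDerivAt_left
    (h.intervalIntegrable_abelIntegrand hk0 hk1 ht)
    (hcont.stronglyMeasurableAtFilter isOpen_Ioo t ht)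
    (hcont.continuousAt (isOpen_Ioo.mem_nhds ht))).const_sub α
  rwa [neg_neg] at hderiv

lemma continuousOn_abelAlong (hk0 : k ≠ 0) (hk1 : k ^ 2 < 1) (α : ℂ) {t : ℝ}
    (ht : t ∈ Set.Ioo (0 : ℝ) 1) : ContinuousOn (abelAlong ζ η α) (Set.Icc t 1) := by
  have hint := h.intervalIntegrable_abelIntegrand hk0 hk1 ht
  rw [intervalIntegrable_iff_integrableOn_Icc_of_le ht.2.le, ← Set.uIcc_of_le ht.2.le] at hint
  rw [← Set.uIcc_of_le ht.2.le]
  exact continuousOn_const.sub (intervalIntegral.continuousOn_primitive_interval_left hint)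

lemma eventually_zeta_ne_zero : ∀ᶠ t in 𝓝[>] (0 : ℝ), ζ t ≠ 0 := by
  filter_upwards [h.tendsto_zeta.eventually (eventually_gt_atTop 0)] with t ht
  exact norm_pos_iff.1 ht

lemma tendsto_inv_I_mul_zeta : Tendsto (fun t => (I * ζ t)⁻¹) (𝓝[>] 0) (𝓝 0) := by
  refine tendsto_inv₀_cobounded.comp (tendsto_norm_atTop_iff_cobounded.1 ?_)
  simpa only [norm_mul, norm_I, one_mul] using h.tendsto_zeta

lemma tendsto_inv_sheet :
    Tendsto (fun t => -(4 * I * η t) / (I * ζ t) ^ 2) (𝓝[>] 0) (𝓝 (2 * (ellipticK k : ℂ))) := by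
  have hsheet := h.tendsto_sheet.const_mul (4 * I)
  rw [show 4 * I * -(I * (ellipticK k : ℂ) / 2) = 2 * (ellipticK k : ℂ) by
    linear_combination -2 * (ellipticK k : ℂ) * I_sq] at hsheet
  refine hsheet.congr fun t => ?_
  rw [mul_pow, I_sq]
  ring

lemma hasDerivAt_inv_I_mul_zeta {t : ℝ} (ht : t ∈ Set.Ioo (0 : ℝ) 1) (hζ : ζ t ≠ 0) :
    HasDerivAt (fun t => (I * ζ t)⁻¹)
      (abelIntegrand ζ η t * (-(4 * I * η t) / (I * ζ t) ^ 2)) t := by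
  refine ((h.hasDerivAt_I_mul_zeta ht).inv (mul_ne_zero I_ne_zero hζ)).congr_deriv ?_
  ring

end IsPathFromInfinity

lemma OnCurve.inv_sq_eq_curveQuartic {k : ℝ} {ζ η : ℂ} (h : OnCurve k ζ η) (hζ : ζ ≠ 0) :
    (-(4 * I * η) / (I * ζ) ^ 2) ^ 2 = curveQuartic k (I * ζ)⁻¹ := by
  rw [curveQuartic_inv k (mul_ne_zero I_ne_zero hζ), ← h.sq_eq_curveQuartic, div_pow, neg_sq,
    ← pow_mul]

/-- The point `(ζ, η)` of the curve has the theta-functional parametrisation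
`i ζ = θ₂ θ₄ / (θ₁ θ₃)`, `4 i η = d (i ζ) / dv` at the argument `v`; denominators are cleared. -/
structure IsThetaPoint (τ ζ η v : ℂ) : Prop where
  zeta_eq : I * ζ * thetaDen τ v = thetaNum τ v
  eta_eq : 4 * I * η * thetaDen τ v ^ 2 = -(thetaWronskian τ * theta3 τ (2 * v))

section Inversion

variable {t₀ : ℝ} (ht₀ : 0 < t₀)
include ht₀

lemma thetaWronskian_mul_sq (v : ℂ) :
    (thetaWronskian (I * t₀) * theta3 (I * t₀) (2 * v)) ^ 2 =
      4 * (ellipticK (thetaModulus t₀) : ℂ) ^ 2 * (thetaNum (I * t₀) v ^ 4 -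
        2 * ((thetaModulus t₀ : ℂ) ^ 2 - (coModulus (thetaModulus t₀) : ℂ) ^ 2) *
          thetaNum (I * t₀) v ^ 2 * thetaDen (I * t₀) v ^ 2 + thetaDen (I * t₀) v ^ 4) := by
  have h3 := theta3_zero_ne_zero ht₀
  rw [ellipticK_thetaModulus ht₀, thetaModulus_sq_sub_coModulus_sq ht₀,
    thetaWronskian_eq (theta2_zero_ne_zero ht₀) h3 (theta4_zero_ne_zero ht₀)]
  field_simp
  linear_combination 4 * thetaK (I * t₀) ^ 2 * theta3_two_mul_sq (I_mul_ofReal_im_pos ht₀) v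

lemma deriv_thetaDen_div_sq_eq_curveQuartic {v : ℂ} (hv : thetaNum (I * t₀) v ≠ 0) :
    (thetaWronskian (I * t₀) * theta3 (I * t₀) (2 * v) / thetaNum (I * t₀) v ^ 2) ^ 2 =
      curveQuartic (thetaModulus t₀) (thetaDen (I * t₀) v / thetaNum (I * t₀) v) := by
  rw [div_pow, thetaWronskian_mul_sq ht₀, curveQuartic]
  field_simp
  ring

lemma deriv_thetaDen_div_zero :
    thetaWronskian (I * t₀) * theta3 (I * t₀) (2 * 0) / thetaNum (I * t₀) 0 ^ 2 =
      2 * (ellipticK (thetaModulus t₀) : ℂ) := by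
  have h2 := theta2_zero_ne_zero ht₀
  have h3 := theta3_zero_ne_zero ht₀
  have h4 := theta4_zero_ne_zero ht₀
  rw [ellipticK_thetaModulus ht₀, thetaWronskian_eq h2 h3 h4, thetaNum, mul_zero]
  field_simp

lemma deriv_thetaNum_div_sq_eq_curveQuartic {v : ℂ} (hv : thetaDen (I * t₀) v ≠ 0) :
    (-(thetaWronskian (I * t₀) * theta3 (I * t₀) (2 * v)) / thetaDen (I * t₀) v ^ 2) ^ 2 =
      curveQuartic (thetaModulus t₀) (thetaNum (I * t₀) v / thetaDen (I * t₀) v) := by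
  rw [div_pow, neg_sq, thetaWronskian_mul_sq ht₀, curveQuartic]
  field_simp

lemma IsThetaPoint.thetaDen_ne_zero {ζ η v : ℂ} (h : IsThetaPoint (I * t₀) ζ η v) :
    thetaDen (I * t₀) v ≠ 0 := by
  intro hD
  have hN : thetaNum (I * t₀) v = 0 := by rw [← h.zeta_eq, hD, mul_zero]
  exact (thetaNum_ne_zero_or_thetaDen_ne_zero (I_mul_ofReal_im_pos ht₀) (theta2_zero_ne_zero ht₀)
    (theta3_zero_ne_zero ht₀) (theta4_zero_ne_zero ht₀) v).elim (· hN) (· hD)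

variable {ζ η : ℝ → ℂ} {ζ₀ η₀ α : ℂ}
  (h : IsPathFromInfinity (thetaModulus t₀) ζ η ζ₀ η₀)
include h

-- Near `∞₁` the curve is followed in the coordinate `1 / (i ζ) = θ₁ θ₃ / (θ₂ θ₄)`.
lemma eventually_isThetaPoint_nhdsGT_zero (hα : Tendsto (abelAlong ζ η α) (𝓝[>] 0) (𝓝 0)) :
    ∀ᶠ t in 𝓝[>] (0 : ℝ), IsThetaPoint (I * t₀) (ζ t) (η t) (abelAlong ζ η α t) := by
  have hτ := I_mul_ofReal_im_pos ht₀
  have hk0 := (thetaModulus_pos ht₀).ne'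
  have hk1 := thetaModulus_sq_lt_one ht₀
  have hN0 : thetaNum (I * t₀) 0 ≠ 0 :=
    mul_ne_zero (theta2_zero_ne_zero ht₀) (theta4_zero_ne_zero ht₀)
  have hNc := (differentiable_thetaNum hτ).continuous
  have h3c := (differentiable_theta3 hτ).continuous
  have hN : ∀ᶠ v in 𝓝 (0 : ℂ), thetaNum (I * t₀) v ≠ 0 := hNc.continuousAt.eventually_ne hN0
  have hunit : ∀ᶠ t in 𝓝[>] (0 : ℝ), t ∈ Set.Ioo (0 : ℝ) 1 := Ioo_mem_nhdsGT one_pos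
  have hφ₀ : thetaDen (I * t₀) 0 / thetaNum (I * t₀) 0 = 0 := by
    rw [thetaDen, theta1_zero, zero_mul, zero_div]
  have hω₀ := deriv_thetaDen_div_zero ht₀
  have hlocal := eventually_eq_comp_of_hasDerivAt (hN.mono fun _ => hasDerivAt_thetaDen_div hτ)
    (ContinuousAt.div (by fun_prop) (by fun_prop) (pow_ne_zero 2 hN0))
    (by simpa only [hω₀, ellipticK_thetaModulus ht₀] using
      mul_ne_zero two_ne_zero (thetaK_ne_zero ht₀))
    (hN.mono fun _ => deriv_thetaDen_div_sq_eq_curveQuartic ht₀)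
    ((hunit.and h.eventually_zeta_ne_zero).mono fun _ ht => h.hasDerivAt_inv_I_mul_zeta ht.1 ht.2)
    (hunit.mono fun _ ht => h.hasDerivAt_abelAlong hk0 hk1 α ht)
    ((hunit.and h.eventually_zeta_ne_zero).mono fun t ht =>
      (h.onCurve t (Set.Ioo_subset_Ioc_self ht.1)).inv_sq_eq_curveQuartic ht.2)
    (by simpa only [hφ₀] using h.tendsto_inv_I_mul_zeta)
    (by simpa only [hω₀] using h.tendsto_inv_sheet) hα
  filter_upwards [hlocal, h.eventually_zeta_ne_zero, hα.eventually hN] with t ht hζt hNt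
  have hwt := mul_ne_zero I_ne_zero hζt
  have hζ : I * ζ t * thetaDen (I * t₀) (abelAlong ζ η α t) =
      thetaNum (I * t₀) (abelAlong ζ η α t) := by
    rw [inv_eq_one_div, div_eq_div_iff hwt hNt, one_mul] at ht
    rw [ht.1, mul_comm]
  refine ⟨hζ, mul_left_cancel₀ (pow_ne_zero 2 hwt) ?_⟩
  have hη := ht.2
  rw [div_eq_div_iff (pow_ne_zero 2 hwt) (pow_ne_zero 2 hNt), ← hζ] at hη
  linear_combination -hη

lemma eventually_isThetaPoint_nhdsGT {s : ℝ} (hs : s ∈ Set.Ioo (0 : ℝ) 1)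
    (hpoint : IsThetaPoint (I * t₀) (ζ s) (η s) (abelAlong ζ η α s)) :
    ∀ᶠ t in 𝓝[>] s, IsThetaPoint (I * t₀) (ζ t) (η t) (abelAlong ζ η α t) := by
  have hτ := I_mul_ofReal_im_pos ht₀
  have hk0 := (thetaModulus_pos ht₀).ne'
  have hk1 := thetaModulus_sq_lt_one ht₀
  have hD0 := hpoint.thetaDen_ne_zero ht₀
  have hDc := (differentiable_thetaDen hτ).continuous
  have h3c := (differentiable_theta3 hτ).continuous
  have hD := hDc.continuousAt.eventually_ne hD0
  have hunit : ∀ᶠ t in 𝓝[>] s, t ∈ Set.Ioo (0 : ℝ) 1 :=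
    mem_nhdsWithin_of_mem_nhds (isOpen_Ioo.mem_nhds hs)
  have hφs := (eq_div_of_mul_eq hD0 hpoint.zeta_eq).symm
  have hωs := (eq_div_of_mul_eq (pow_ne_zero 2 hD0) hpoint.eta_eq).symm
  have hζc := (h.hasDerivAt_zeta hs).continuousAt.continuousWithinAt (s := Set.Ioi s)
  have hηc := (h.hasDerivAt_eta hs).continuousAt.continuousWithinAt (s := Set.Ioi s)
  have hαc := (h.hasDerivAt_abelAlong hk0 hk1 α hs).continuousAt.continuousWithinAt
    (s := Set.Ioi s)
  have hlocal := eventually_eq_comp_of_hasDerivAt (hD.mono fun _ => hasDerivAt_thetaNum_div hτ)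
    (ContinuousAt.div (by fun_prop) (by fun_prop) (pow_ne_zero 2 hD0))
    (by simpa only [hωs] using
      mul_ne_zero (mul_ne_zero (by norm_num) I_ne_zero) (h.eta_ne_zero s hs))
    (hD.mono fun _ => deriv_thetaNum_div_sq_eq_curveQuartic ht₀)
    (hunit.mono fun _ => h.hasDerivAt_I_mul_zeta)
    (hunit.mono fun _ => h.hasDerivAt_abelAlong hk0 hk1 α)
    (hunit.mono fun t ht => (h.onCurve t (Set.Ioo_subset_Ioc_self ht)).sq_eq_curveQuartic)
    (by simpa only [hφs] using hζc.tendsto.const_mul I)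
    (by simpa only [hωs] using hηc.tendsto.const_mul (4 * I)) hαc
  filter_upwards [hlocal, hαc.eventually hD] with t ht hDt
  exact ⟨by rw [ht.1, div_mul_cancel₀ _ hDt],
    by rw [ht.2, div_mul_cancel₀ _ (pow_ne_zero 2 hDt)]⟩

lemma isClosed_setOf_isThetaPoint (α : ℂ) {a : ℝ} (ha : a ∈ Set.Ioo (0 : ℝ) 1) :
    IsClosed ({t | IsThetaPoint (I * t₀) (ζ t) (η t) (abelAlong ζ η α t)} ∩ Set.Icc a 1) := by
  have hτ := I_mul_ofReal_im_pos ht₀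
  have hsub : Set.Icc a 1 ⊆ Set.Ioc 0 1 := fun r hr => ⟨ha.1.trans_le hr.1, hr.2⟩
  have hζc := h.contDiffOn_zeta.continuousOn.mono hsub
  have hηc := h.contDiffOn_eta.continuousOn.mono hsub
  have hαc := h.continuousOn_abelAlong (thetaModulus_pos ht₀).ne' (thetaModulus_sq_lt_one ht₀) α ha
  have hDc : ContinuousOn (fun t => thetaDen (I * t₀) (abelAlong ζ η α t)) (Set.Icc a 1) :=
    (differentiable_thetaDen hτ).continuous.comp_continuousOn hαc
  have hNc : ContinuousOn (fun t => thetaNum (I * t₀) (abelAlong ζ η α t)) (Set.Icc a 1) :=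
    (differentiable_thetaNum hτ).continuous.comp_continuousOn hαc
  have h3c : ContinuousOn (fun t => theta3 (I * t₀) (2 * abelAlong ζ η α t)) (Set.Icc a 1) :=
    (differentiable_theta3 hτ).continuous.comp_continuousOn (hαc.const_mul 2)
  have hdefect : ContinuousOn (fun t =>
      (I * ζ t * thetaDen (I * t₀) (abelAlong ζ η α t) - thetaNum (I * t₀) (abelAlong ζ η α t),
        4 * I * η t * thetaDen (I * t₀) (abelAlong ζ η α t) ^ 2 +
          thetaWronskian (I * t₀) * theta3 (I * t₀) (2 * abelAlong ζ η α t))) (Set.Icc a 1) := by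
    fun_prop
  convert hdefect.preimage_isClosed_of_isClosed isClosed_Icc
    (isClosed_singleton (x := ((0, 0) : ℂ × ℂ))) using 1
  ext t
  simp only [Set.mem_inter_iff, Set.mem_ofPred_eq, Set.mem_preimage, Set.mem_singleton_iff,
    Prod.mk.injEq, sub_eq_zero, add_eq_zero_iff_eq_neg]
  exact ⟨fun ht => ⟨ht.2, ht.1.zeta_eq, ht.1.eta_eq⟩, fun ht => ⟨⟨ht.2.1, ht.2.2⟩, ht.1⟩⟩

end Inversion

-- The parametrisation holds near the start of the path, and the set of parameters for which it
-- holds is closed and open to the right.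
lemma theta_inversion {t₀ : ℝ} (ht₀ : 0 < t₀) {ζ₀ η₀ α : ℂ}
    (habel : IsAbelImage (thetaModulus t₀) ζ₀ η₀ α) :
    thetaDen (I * t₀) α ≠ 0 ∧ I * ζ₀ = thetaNum (I * t₀) α / thetaDen (I * t₀) α := by
  obtain ⟨ζ, η, hpath, hα⟩ := habel
  have hstart : Tendsto (abelAlong ζ η α) (𝓝[>] 0) (𝓝 0) := by
    rw [← sub_self α]
    exact hα.const_sub α
  obtain ⟨a, hpoint, ha⟩ := ((eventually_isThetaPoint_nhdsGT_zero ht₀ hpath hstart).and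
    (Ioo_mem_nhdsGT one_pos)).exists
  have hcover := (isClosed_setOf_isThetaPoint ht₀ hpath α ha).Icc_subset_of_forall_mem_nhdsWithin
    hpoint fun s hs => eventually_isThetaPoint_nhdsGT ht₀ hpath
      ⟨ha.1.trans_le hs.2.1, hs.2.2⟩ hs.1
  have hend : IsThetaPoint (I * t₀) (ζ 1) (η 1) (abelAlong ζ η α 1) := hcover ⟨ha.2.le, le_rfl⟩
  rw [abelAlong_one, hpath.zeta_one] at hend
  have hD := hend.thetaDen_ne_zero ht₀
  exact ⟨hD, eq_div_of_mul_eq hD hend.zeta_eq⟩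

end MonopoleCurve

theorem theorem7p1 (κ : ℝ) (hκ0 : 0 < κ) (hκ1 : κ < 1) (ζ η α : Fin 4 → ℂ)
    (hcurve : ∀ s, MonopoleCurve.OnCurve κ (ζ s) (η s))
    (habel : ∀ s, MonopoleCurve.IsAbelImage κ (ζ s) (η s) (α s)) (z : ℂ) :
    -- no denominator of the formula vanishes
    (∀ s, MonopoleCurve.theta1 (MonopoleCurve.period κ) (α s) ≠ 0 ∧
      MonopoleCurve.theta3 (MonopoleCurve.period κ) (α s) ≠ 0) ∧
    ∀ i j k l : Fin 4, [i, j, k, l].Nodup →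
      (MonopoleCurve.Psi (MonopoleCurve.period κ) z ζ α).adjugate.transpose.col i =
        MonopoleCurve.dFactor (MonopoleCurve.period κ) z α i j k l •
          MonopoleCurve.adjVector (MonopoleCurve.period κ) z ζ α i j k l := by
  obtain ⟨t, ht, rfl⟩ := MonopoleCurve.exists_thetaModulus_eq hκ0 hκ1
  rw [MonopoleCurve.period_thetaModulus ht]
  have hinv := fun s => MonopoleCurve.theta_inversion ht (habel s)
  exact ⟨fun s => mul_ne_zero_iff.1 (hinv s).1, fun _ _ _ _ hijkl =>
    MonopoleCurve.adjugate_transpose_col_Psi (MonopoleCurve.I_mul_ofReal_im_pos ht) z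
      (fun s => (hinv s).1) (fun s => (hinv s).2) hijkl⟩
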